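/- **Notation.** $\mathbb N$ is the set of positive integers and $[n]=\{1,\dots,n\}$; $[n]_p$ is the random subset of $[n]$ containing each element independently with probability $p\in[0,1]$. A system of linear equations $A$ is of the form $A'x=b$ with $A'$ an integer $\ell_A\times k_A$ matrix (its *underlying matrix*) and $b\in\mathbb Z^{\ell_A}$. A *distinct solution* to $A$ in a set $S\subseteq\mathbb Z$ is a solution $x\in S^{k_A}$ with pairwise distinct coordinates. A system is *irredundant* if it has a distinct solution in $\mathbb N$; a matrix $M$ is irredundant if $Mx=0$ is. A matrix has *full rank* if its rank equals its number of rows; a system has full rank if its underlying matrix does. A matrix $M$ is *partition regular* if every finite colouring of $\mathbb N$ has a monochromatic solution to $Mx=0$ in $\mathbb N$. A set $S\subseteq\mathbb Z$ is *$(A_1,\dots,A_r)$-Rado* if for every colouring of $S$ with colours $1,\dots,r$ there are $i$ and a distinct solution to $A_i$ in $S$ all of whose coordinates have colour $i$; if all $A_i$ equal $A$ we say *$(A,r)$-Rado* (a matrix $M$ being identified with the system $Mx=0$). For an integer matrix $M$ with columns indexed by $[k]$ and $V\subseteq[k]$, let $M_V$ be the matrix formed by the columns in $V$ (of rank $0$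 if $V=\emptyset$), and $\overline W=[k]\setminus W$. Put $$m(M)=\max_{W\subseteq[k],\,|W|\ge2}\frac{|W|-1}{|W|-1+\operatorname{rank}(M_{\overline W})-\operatorname{rank}(M)},$$ $$m(M,N)=\max_{W\subseteq[k],\,|W|\ge2}\frac{|W|}{|W|-1+\operatorname{rank}(M_{\overline W})-\operatorname{rank}(M)+1/m(N)},$$ and for systems $m(A,B)=m(A',B')$ with $A',B'$ the underlying matrices. An $\ell\times k$ matrix $M$ of full rank is *strictly balanced* if $\frac{|W|-1}{|W|-1+\operatorname{rank}(M_{\overline W})-\ell}<\frac{k-1}{k-1-\ell}$ for all $W\subseteq[k]$ with $2\le|W|<k$. A *core* of an irredundant partition regular matrix $M$ is an integer matrix $C$, irredundant, of full rank and strictly balanced, with $m(C)=m(M)$, that is obtained from $M$ by rational row operations, deletion of rows, and then deletion of columns that are zero in all remaining rows. **Theorem.** (a) Let $k,\ell$ be positive integers with $k\ge\ell+2$. There is a constant $c>0$, depending only on $k$ and $\ell$, such that the following holds. Let $A$ and $B$ be systems of linear equations such that $A$, $B$ and their underlying matrices are irredundant and of full rank, the underlying matrices are partition regular, and each underlying matrix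 has a core of dimension $\ell\times k$. Then $\frac1{m(A,B)}=\frac{k-\ell-1}{k-1}$, and if $p=p(n)\le c\,n^{-1/m(A,B)}=c\,n^{-\frac{k-\ell-1}{k-1}}$ (for all large $n$), then $$\lim_{n\to\infty}\mathbb P\big[[n]_p\text{ is }(A,B)\text{-Rado}\big]=0.$$ (b) In particular (the $0$-statement of the random Rado theorem of Rödl and Ruciński): for every irredundant partition regular integer matrix $A$ of full rank with at least one row, and every integer $r\ge2$, there is a constant $c>0$ such that if $p=p(n)<c\,n^{-1/m(A)}$ (for all large $n$), then $$\lim_{n\to\infty}\mathbb P\big[[n]_p\text{ is }(A,r)\text{-Rado}\big]=0.$$ -/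

import Mathlib

open Matrix Filter Topology MeasureTheory ProbabilityTheory unitInterval

noncomputable section

namespace RandomRado

/-- A finite system of linear equations `mat * x = rhs` with integer coefficients, in `cols`
variables; `mat` is its underlying matrix. -/
structure LinearSystem where
  rows : ℕ
  cols : ℕ
  mat : Matrix (Fin rows) (Fin cols) ℤ
  rhs : Fin rows → ℤ

/-- `x` is a `k`-distinct solution to `A x = b` in `S`: a solution with pairwise distinct
coordinates, all of them in `S`. -/
def IsDistinctSolution {ℓ k : ℕ} (A : Matrix (Fin ℓ) (Fin k) ℤ) (b : Fin ℓ → ℤ) (S : Set ℤ)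
    (x : Fin k → ℤ) : Prop :=
  Function.Injective x ∧ (∀ j, x j ∈ S) ∧ A *ᵥ x = b

/-- `A x = b` is irredundant: it has a `k`-distinct solution in the positive integers.
A matrix `A` is irredundant if this holds with `b = 0`. -/
def Irredundant {ℓ k : ℕ} (A : Matrix (Fin ℓ) (Fin k) ℤ) (b : Fin ℓ → ℤ) : Prop :=
  ∃ x, IsDistinctSolution A b {z | 0 < z} x

/-- Every finite colouring of the positive integers has a monochromatic solution to `A x = 0`
(not necessarily with distinct coordinates). -/
def PartitionRegular {ℓ k : ℕ} (A : Matrix (Fin ℓ) (Fin k) ℤ) : Prop :=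
  ∀ (r : ℕ) (χ : ℤ → Fin r), ∃ (c : Fin r) (x : Fin k → ℤ),
    (∀ j, 0 < x j ∧ χ (x j) = c) ∧ A *ᵥ x = 0

/-- The rank (over `ℚ`) of the matrix formed by the columns of `A` indexed by `V`. -/
def colRank {ℓ k : ℕ} (A : Matrix (Fin ℓ) (Fin k) ℤ) (V : Finset (Fin k)) : ℕ :=
  ((A.map (Int.cast : ℤ → ℚ)).submatrix id (Subtype.val : {j // j ∈ V} → Fin k)).rank

/-- The rank of `A` equals its number of rows. -/
def FullRank {ℓ k : ℕ} (A : Matrix (Fin ℓ) (Fin k) ℤ) : Prop :=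
  colRank A Finset.univ = ℓ

/-- `m(A)`, the maximum over `W ⊆ [k]` with `|W| ≥ 2` of
`(|W| - 1) / (|W| - 1 + rank A_{[k] ∖ W} - rank A)`. All denominators are positive when `A` is
irredundant and partition regular. -/
def mParam {ℓ k : ℕ} (A : Matrix (Fin ℓ) (Fin k) ℤ) : ℝ :=
  ⨆ W : {W : Finset (Fin k) // 2 ≤ W.card},
    ((W.1.card : ℝ) - 1) /
      ((W.1.card : ℝ) - 1 + (colRank A (W.1)ᶜ : ℝ) - (colRank A Finset.univ : ℝ))

/-- `m(A, B)`, the maximum over `W ⊆ [k_A]` with `|W| ≥ 2` of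
`|W| / (|W| - 1 + rank A_{[k_A] ∖ W} - rank A + 1 / m(B))`. -/
def mPair {ℓA kA ℓB kB : ℕ} (A : Matrix (Fin ℓA) (Fin kA) ℤ) (B : Matrix (Fin ℓB) (Fin kB) ℤ) :
    ℝ :=
  ⨆ W : {W : Finset (Fin kA) // 2 ≤ W.card},
    (W.1.card : ℝ) /
      ((W.1.card : ℝ) - 1 + (colRank A (W.1)ᶜ : ℝ) - (colRank A Finset.univ : ℝ) + 1 / mParam B)

/-- An `ℓ × k` matrix of full rank is strictly balanced if `W = [k]` is the unique maximiser in
the definition of `m`. -/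
def StrictlyBalanced {ℓ k : ℕ} (A : Matrix (Fin ℓ) (Fin k) ℤ) : Prop :=
  ∀ W : Finset (Fin k), 2 ≤ W.card → W.card < k →
    ((W.card : ℝ) - 1) / ((W.card : ℝ) - 1 + (colRank A Wᶜ : ℝ) - (ℓ : ℝ))
      < ((k : ℝ) - 1) / ((k : ℝ) - 1 - (ℓ : ℝ))

/-- `C` is a core of `A`. It is obtained from `A` by (rational) row operations followed by deleting
rows, and then deleting columns that vanish on the remaining rows: the rows of `C`, extended by `0`
to the deleted columns, are the rows of `P * A`. Hence every solution to `A x = 0` contains a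
solution to `C y = 0` as an ordered subvector. Moreover `m(C) = m(A)`, and `C` is irredundant, of
full rank and strictly balanced. -/
structure IsCore {ℓA kA ℓ k : ℕ} (A : Matrix (Fin ℓA) (Fin kA) ℤ)
    (C : Matrix (Fin ℓ) (Fin k) ℤ) : Prop where
  obtained : ∃ (e : Fin k ↪o Fin kA) (P : Matrix (Fin ℓ) (Fin ℓA) ℚ),
    (∀ i j, (P * A.map (Int.cast : ℤ → ℚ)) i (e j) = (C i j : ℚ)) ∧
    (∀ i, ∀ j ∉ Set.range e, (P * A.map (Int.cast : ℤ → ℚ)) i j = 0)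
  mParam_eq : mParam C = mParam A
  irredundant : Irredundant C 0
  fullRank : FullRank C
  strictlyBalanced : StrictlyBalanced C

/-- `S` is `(A_1, …, A_r)`-Rado: for every `r`-colouring there are a colour `i` and a distinct
solution in `S` to the `i`-th system all of whose coordinates have colour `i`. (Only the colours of
the elements of `S` matter.) -/
def IsRado {r : ℕ} (A : Fin r → LinearSystem) (S : Set ℤ) : Prop :=
  ∀ χ : ℤ → Fin r, ∃ i, ∃ x, IsDistinctSolution (A i).mat (A i).rhs S x ∧ ∀ j, χ (x j) = i

/-- The probability that the binomial random set `[n]_p` is `(A_1, …, A_r)`-Rado. -/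
def radoProb {r : ℕ} (A : Fin r → LinearSystem) (n : ℕ) (p : I) : ℝ :=
  (setBernoulli (Set.Icc (1 : ℤ) (n : ℤ)) p).real {S | IsRado A S}

end RandomRado

end

noncomputable section

namespace RandomRado

open Module

/-! ### Growing edge sequences in uniform hypergraphs -/

section Hypergraph

variable {α : Type*} [DecidableEq α]

/-! Only the first two colours are used. Every solution of a system contains, on the columns of a
core, a member of a set `Y i` lying in a translate of a rational subspace of dimension `D`. So it
suffices to show that, with probability tending to 1, the random set has a two-colouring in which no
injective member of `Y i` has colour `i` throughout. The coordinate sets of these members form a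
`k`-uniform hypergraph. Write θ = `expo k D` = (D - 1)/(k - 1); the threshold is n^(-θ).

Deterministic part. If every two-colouring fails, a minimal family of coloured edges with this
property gives a `Critical` hypergraph (`exists_critical`): every vertex of every edge is the whole
intersection with some other edge, and no union of components is two-colourable.
`Critical.exists_grow` shows that such a hypergraph contains a path with `T` steps, or else a
connected sequence of O(T) edges with at most five exceptional steps, two of which close up: one
meets the earlier edges in exactly two vertices, the other in at least two but not all. To see this,
prolong a path maximally and link two new vertices of its last edge back. This closes two cycles,
and unless a second gain arises they span the same vertices. That forces `k = 3` and the Pasch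
configuration on six vertices, in which non-two-colourability supplies one more edge and a
contradiction.

Probabilistic part. If r(W) is the dimension of the projection to the coordinates `W`, an edge
meeting a set of size u in the coordinates `W` can be chosen in at most u^|W| n^(D - r(W)) ways
(`card_solutions_le`) and costs p^(k - |W|). For p ≤ c n^(-θ) the power of `n` is at most θ(|W| - 1)
- (r(W) - 1). This is at most 0 for one old vertex and at most -(1 - θ) for two; for three or more
(but not all), strict balancedness makes it at most -1/(k - 1) (`count_mul_gain_le`). A path step
attaches to the preceding edge, so `c` makes its expected count at most 1/2; an exceptional step may
attach anywhere, which costs a power of `T`. The first edge contributes at most 2 n^(1 - θ). With T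
= ⌈log₂ n⌉ the long paths contribute at most 2 n^(-θ). In the other case the step with two old
vertices cancels n^(1 - θ), and the second gain leaves n^(-1/(k - 1)) times a power of log n. Both
tend to 0 (`tendsto_unavoidable`).

Algebraic part. Rank-nullity turns the denominators of `mParam` into r(W) - 1 (`colRank_sub`).
Partition regularity gives r(W) ≥ 2 for |W| ≥ 2, since two coordinates in a fixed ratio other than 1
are separated by a colouring by prime valuations (`two_le_projRank`). For a single matrix no core is
constructed: projecting the kernel to a smallest maximiser `W` of `mParam` is automatically strictly
balanced. -/

/-- `Grow E k j a b l U e` holds if there is a sequence of `l + 1` edges of `E` with union `U` and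
last edge `e` in which every edge meets the union of its predecessors. Apart from `j` exceptional
steps each edge meets that union in one vertex, which lies in the preceding edge. Among the
exceptional steps, `a` meet it in exactly two vertices and `b` further ones in at least two but
not all vertices. -/
inductive Grow (E : Set (Finset α)) (k : ℕ) : ℕ → ℕ → ℕ → ℕ → Finset α → Finset α → Prop
  | start {e : Finset α} (he : e ∈ E) : Grow E k 0 0 0 0 e e
  | run {j a b l : ℕ} {U e f : Finset α} (h : Grow E k j a b l U e) (hf : f ∈ E)
      (hc : (f ∩ U).card = 1) (hm : (f ∩ e).Nonempty) : Grow E k j a b (l + 1) (U ∪ f) f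
  | jump {j a b l : ℕ} {U e f : Finset α} (h : Grow E k j a b l U e) (hf : f ∈ E)
      (hc : (f ∩ U).card = 1) : Grow E k (j + 1) a b (l + 1) (U ∪ f) f
  | two {j a b l : ℕ} {U e f : Finset α} (h : Grow E k j a b l U e) (hf : f ∈ E)
      (hc : (f ∩ U).card = 2) : Grow E k (j + 1) (a + 1) b (l + 1) (U ∪ f) f
  | gain {j a b l : ℕ} {U e f : Finset α} (h : Grow E k j a b l U e) (hf : f ∈ E)
      (hc : 2 ≤ (f ∩ U).card) (hc' : (f ∩ U).card < k) :
      Grow E k (j + 1) a (b + 1) (l + 1) (U ∪ f) f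

/-- A `k`-uniform hypergraph in which every edge is met in exactly one prescribed vertex by some
other edge, and no union of components of which has a proper two-colouring. -/
structure Critical (E : Set (Finset α)) (k : ℕ) : Prop where
  nonempty : E.Nonempty
  uniform : ∀ e ∈ E, e.card = k
  link : ∀ e ∈ E, ∀ v ∈ e, ∃ f ∈ E, f ∩ e = {v}
  closed : ∀ U : Finset α, (∀ e ∈ E, e ⊆ U ∨ Disjoint e U) → (∃ e ∈ E, e ⊆ U) →
    ∀ R : Finset α, ∃ e ∈ E, e ⊆ U ∧ (e ⊆ R ∨ Disjoint e R)

variable {E E' : Set (Finset α)} {k j a b l : ℕ} {U U' e f : Finset α}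

lemma Grow.mono (hE : E ⊆ E') (h : Grow E k j a b l U e) : Grow E' k j a b l U e := by
  induction h with
  | start he => exact .start (hE he)
  | run _ hf hc hm ih => exact .run ih (hE hf) hc hm
  | jump _ hf hc ih => exact .jump ih (hE hf) hc
  | two _ hf hc ih => exact .two ih (hE hf) hc
  | gain _ hf hc hc' ih => exact .gain ih (hE hf) hc hc'

lemma card_add_inter (U f : Finset α) : (U ∪ f).card + (f ∩ U).card = U.card + f.card := by
  rw [Finset.inter_comm]; exact Finset.card_union_add_card_inter U f

/-- Each step adds `k - 1` vertices, except that a step of type `two` adds one fewer. For sequences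
with equal `a` and `b = 0`, the union therefore determines the length when `k ≥ 2`. -/
lemma Grow.card_eq (hk : 1 ≤ k) (hu : ∀ e ∈ E, e.card = k) (h : Grow E k j a b l U e)
    (hb : b = 0) : U.card + a = k + l * (k - 1) := by
  obtain ⟨q, rfl⟩ : ∃ q, k = q + 1 := ⟨k - 1, by omega⟩
  induction h with
  | start he => simp [hu _ he]
  | @run j a b l U e f _ hf hc hm ih =>
    have := card_add_inter U f
    have := hu _ hf
    have := ih hb
    simp only [Nat.add_sub_cancel, Nat.add_mul] at *
    omega
  | @jump j a b l U e f _ hf hc ih =>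
    have := card_add_inter U f
    have := hu _ hf
    have := ih hb
    simp only [Nat.add_sub_cancel, Nat.add_mul] at *
    omega
  | @two j a b l U e f _ hf hc ih =>
    have := card_add_inter U f
    have := hu _ hf
    have := ih hb
    simp only [Nat.add_sub_cancel, Nat.add_mul] at *
    omega
  | gain => omega

/-- A closed vertex set contains or avoids the union of a grown sequence. -/
lemma Grow.subset_or_disjoint (hcl : ∀ e ∈ E, e ⊆ U' ∨ Disjoint e U')
    (h : Grow E k j a b l U e) : U ⊆ U' ∨ Disjoint U U' := by
  have step : ∀ U f : Finset α, f ∈ E → (f ∩ U).Nonempty → (U ⊆ U' ∨ Disjoint U U') →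
      (U ∪ f ⊆ U' ∨ Disjoint (U ∪ f) U') := by
    rintro U f hf ⟨x, hx⟩ h
    rw [Finset.mem_inter] at hx
    rcases hcl f hf with hf | hf <;> rcases h with h | h
    · exact .inl (Finset.union_subset h hf)
    · exact absurd (hf hx.1) (Finset.disjoint_left.1 h hx.2)
    · exact absurd (h hx.2) (Finset.disjoint_left.1 hf hx.1)
    · exact .inr (Finset.disjoint_union_left.2 ⟨h, hf⟩)
  have pos : ∀ s : Finset α, 1 ≤ s.card → s.Nonempty := fun s h => Finset.card_pos.1 h
  induction h with
  | start he => exact hcl _ he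
  | run _ hf hc hm ih => exact step _ _ hf (pos _ (by omega)) ih
  | jump _ hf hc ih => exact step _ _ hf (pos _ (by omega)) ih
  | two _ hf hc ih => exact step _ _ hf (pos _ (by omega)) ih
  | gain _ hf hc hc' ih => exact step _ _ hf (pos _ (by omega)) ih

/-! ### Paths -/

/-- The union of `U` and the first `m` members of `e`. -/
def cover (U : Finset α) (e : ℕ → Finset α) (m : ℕ) : Finset α :=
  U ∪ (Finset.range m).biUnion e

lemma mem_cover {e : ℕ → Finset α} {m : ℕ} {x : α} :
    x ∈ cover U e m ↔ x ∈ U ∨ ∃ i < m, x ∈ e i := by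
  simp [cover]

lemma cover_zero (e : ℕ → Finset α) : cover U e 0 = U := by simp [cover]

lemma cover_succ (e : ℕ → Finset α) (m : ℕ) : cover U e (m + 1) = cover U e m ∪ e m := by
  ext x
  simp only [Finset.mem_union, mem_cover, Nat.lt_succ_iff_lt_or_eq]
  constructor
  · rintro (h | ⟨i, hi | rfl, h⟩)
    · exact .inl (.inl h)
    · exact .inl (.inr ⟨i, hi, h⟩)
    · exact .inr h
  · rintro ((h | ⟨i, hi, h⟩) | h)
    · exact .inl h
    · exact .inr ⟨i, .inl hi, h⟩
    · exact .inr ⟨m, .inr rfl, h⟩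

lemma cover_mono (e : ℕ → Finset α) {m n : ℕ} (h : m ≤ n) : cover U e m ⊆ cover U e n := by
  intro x
  simp only [mem_cover]
  rintro (hx | ⟨i, hi, hx⟩)
  · exact .inl hx
  · exact .inr ⟨i, by omega, hx⟩

/-- The edges `e 0, …, e t` form a path off `U`: each of them meets the union of `U` and its
predecessors in one vertex, which is new in the preceding edge. The first edge is not
constrained. -/
structure PathOff (E : Set (Finset α)) (U : Finset α) (e : ℕ → Finset α) (t : ℕ) : Prop where
  mem : ∀ i ≤ t, e i ∈ E
  step : ∀ i < t, ∃ x, e (i + 1) ∩ cover U e (i + 1) = {x} ∧ x ∈ e i ∧ x ∉ cover U e i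

/-- Appending a stretch of a sequence, each member of which meets what is present in one
vertex that lies in the preceding member. -/
lemma Grow.append_run {e : ℕ → Finset α} {m n : ℕ} (hmn : m ≤ n)
    (h : Grow E k j a b l U (e m)) (hE : ∀ i, m < i → i ≤ n → e i ∈ E)
    (hc : ∀ i, m ≤ i → i < n →
      (e (i + 1) ∩ (U ∪ (Finset.Ioc m i).biUnion e)).card = 1 ∧ (e (i + 1) ∩ e i).Nonempty) :
    Grow E k j a b (l + (n - m)) (U ∪ (Finset.Ioc m n).biUnion e) (e n) := by
  induction n, hmn using Nat.le_induction with
  | base => simpa using h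
  | succ n hmn ih =>
    have := (ih (fun i h1 h2 => hE i h1 (by omega)) (fun i h1 h2 => hc i h1 (by omega))).run
      (hE (n + 1) (by omega) le_rfl) (hc n hmn (by omega)).1 (hc n hmn (by omega)).2
    have h1 : U ∪ (Finset.Ioc m (n + 1)).biUnion e =
        U ∪ (Finset.Ioc m n).biUnion e ∪ e (n + 1) := by
      rw [← Finset.insert_Ioc_right_eq_Ioc_add_one hmn, Finset.biUnion_insert]
      ac_rfl
    rw [h1, show l + (n + 1 - m) = l + (n - m) + 1 by omega]
    exact this

lemma PathOff.grow {e : ℕ → Finset α} {t m n : ℕ} (hp : PathOff E U e t) (hmn : m ≤ n)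
    (hn : n ≤ t) : Grow E k 0 0 0 (n - m) ((Finset.Icc m n).biUnion e) (e n) := by
  have h := (Grow.start (k := k) (hp.mem m (hmn.trans hn))).append_run hmn
    (fun i _ h => hp.mem i (h.trans hn)) ?_
  · have h1 : e m ∪ (Finset.Ioc m n).biUnion e = (Finset.Icc m n).biUnion e := by
      rw [← Finset.biUnion_insert, Finset.Ioc_insert_left hmn]
    rw [h1] at h
    simpa using h
  · intro i hmi hin
    obtain ⟨x, hx, hxi, -⟩ := hp.step i (by omega)
    have hxe : x ∈ e (i + 1) := (Finset.mem_inter.1 (hx ▸ Finset.mem_singleton_self x)).1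
    refine ⟨Finset.card_eq_one.2 ⟨x, ?_⟩, x, Finset.mem_inter.2 ⟨hxe, hxi⟩⟩
    apply Finset.Subset.antisymm
    · rw [← hx]
      apply Finset.inter_subset_inter_left
      intro y hy
      simp only [Finset.mem_union, Finset.mem_biUnion, Finset.mem_Ioc] at hy
      rw [mem_cover]
      rcases hy with hy | ⟨h, hh, hy⟩
      · exact .inr ⟨m, by omega, hy⟩
      · exact .inr ⟨h, by omega, hy⟩
    · rw [Finset.singleton_subset_iff, Finset.mem_inter]
      refine ⟨hxe, ?_⟩
      simp only [Finset.mem_union, Finset.mem_biUnion, Finset.mem_Ioc]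
      rcases hmi.eq_or_lt with rfl | h
      · exact .inl hxi
      · exact .inr ⟨i, by omega, hxi⟩

/-- Every edge is the start of a path that cannot be prolonged, provided path lengths are
bounded. -/
lemma exists_maximal_path {T : ℕ} (hE : Critical E k)
    (hT : ∀ U e, ¬ Grow E k 0 0 0 T U e) (he : e ∈ E) (U : Finset α) :
    ∃ (p : ℕ → Finset α) (t : ℕ), t < T ∧ p 0 = e ∧ PathOff E U p t ∧
      ∀ v ∈ p t, v ∉ cover U p t →
        ∃ f ∈ E, f ∩ p t = {v} ∧ (f ∩ cover U p t).Nonempty := by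
  classical
  have hbound : ∀ t, (∃ p : ℕ → Finset α, p 0 = e ∧ PathOff E U p t) → t < T := by
    rintro t ⟨p, -, hp⟩
    by_contra h
    exact hT _ _ (by simpa using hp.grow (k := k) (m := 0) (n := T) (by omega) (by omega))
  have h0 : ∃ p : ℕ → Finset α, p 0 = e ∧ PathOff E U p 0 :=
    ⟨fun _ => e, rfl, fun _ _ => he, fun i hi => by omega⟩
  have hPT := Nat.findGreatest_spec (P := fun t => ∃ p : ℕ → Finset α, p 0 = e ∧ PathOff E U p t)
    (m := 0) (n := T) (Nat.zero_le _) h0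
  have hmax : ∀ t, (∃ p : ℕ → Finset α, p 0 = e ∧ PathOff E U p t) →
      t ≤ Nat.findGreatest (fun t => ∃ p : ℕ → Finset α, p 0 = e ∧ PathOff E U p t) T :=
    fun t ht => Nat.le_findGreatest (hbound t ht).le ht
  generalize Nat.findGreatest (fun t => ∃ p : ℕ → Finset α, p 0 = e ∧ PathOff E U p t) T = t
    at hPT hmax
  obtain ⟨p, hp0, hp⟩ := hPT
  refine ⟨p, t, hbound t ⟨p, hp0, hp⟩, hp0, hp, fun v hv hvU => ?_⟩
  obtain ⟨f, hf, hfv⟩ := hE.link _ (hp.mem t le_rfl) v hv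
  refine ⟨f, hf, hfv, ?_⟩
  -- Otherwise `f` meets everything present only in `v`, which is new in `p t`, so appending `f`
  -- gives a longer path.
  by_contra hne
  rw [Finset.not_nonempty_iff_eq_empty] at hne
  have hcov : ∀ i ≤ t + 1, cover U (Function.update p (t + 1) f) i = cover U p i := by
    intro i hi
    ext x
    simp only [mem_cover]
    refine or_congr Iff.rfl (exists_congr fun h => and_congr_right fun hh => ?_)
    rw [Function.update_of_ne (by omega)]
  have := hmax (t + 1) ⟨Function.update p (t + 1) f, by simp [hp0], ?_, ?_⟩
  · omega
  · intro i hi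
    rcases hi.eq_or_lt with rfl | h
    · simpa using hf
    · rw [Function.update_of_ne (by omega)]
      exact hp.mem i (by omega)
  · intro i hi
    rw [hcov _ (by omega), hcov _ (by omega), Function.update_of_ne (a := i) (by omega)]
    rcases (Nat.lt_succ_iff.1 hi).eq_or_lt with rfl | h
    · refine ⟨v, ?_, hv, hvU⟩
      rw [Function.update_self, cover_succ, Finset.inter_union_distrib_left, hne, hfv]
      simp
    · rw [Function.update_of_ne (by omega)]
      exact hp.step i h

/-- The first edge of a path off `U` and the following ones can be appended to a sequence with
union `U`. -/
lemma Grow.append_path {p : ℕ → Finset α} {t m : ℕ} (h : Grow E k j a b l U e)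
    (hp : PathOff E U p t) (h0 : (p 0 ∩ U).card = 1) (hm : m ≤ t + 1) :
    ∃ j' ≤ j + 1, ∃ f, Grow E k j' a b (l + m) (cover U p m) f := by
  rcases Nat.eq_zero_or_pos m with rfl | hm0
  · exact ⟨j, by omega, e, by simpa [cover_zero] using h⟩
  obtain ⟨n, rfl⟩ : ∃ n, m = n + 1 := ⟨m - 1, by omega⟩
  have hU : ∀ i, U ∪ p 0 ∪ (Finset.Ioc 0 i).biUnion p = cover U p (i + 1) := by
    intro i
    ext x
    simp only [Finset.mem_union, Finset.mem_biUnion, Finset.mem_Ioc, mem_cover]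
    constructor
    · rintro ((h | h) | ⟨c, hc, h⟩)
      · exact .inl h
      · exact .inr ⟨0, by omega, h⟩
      · exact .inr ⟨c, by omega, h⟩
    · rintro (h | ⟨c, hc, h⟩)
      · exact .inl (.inl h)
      · rcases Nat.eq_zero_or_pos c with rfl | hc0
        · exact .inl (.inr h)
        · exact .inr ⟨c, by omega, h⟩
  have := (h.jump (hp.mem 0 (by omega)) h0).append_run (n := n) (Nat.zero_le _)
    (fun i _ hi => hp.mem i (by omega)) ?_
  · rw [hU, show l + 1 + (n - 0) = l + (n + 1) by omega] at this
    exact ⟨j + 1, le_rfl, _, this⟩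
  · intro i _ hi
    obtain ⟨x, hx, hxi, -⟩ := hp.step i (by omega)
    rw [hU, hx]
    exact ⟨Finset.card_singleton x, x, Finset.mem_inter.2
      ⟨(Finset.mem_inter.1 (hx ▸ Finset.mem_singleton_self x)).1, hxi⟩⟩

end Hypergraph

/-! ### Leaving a sequence forces a further gain. -/

section Hypergraph

variable {α : Type*} [DecidableEq α] {E : Set (Finset α)} {k j a b l T : ℕ} {U e f : Finset α}

lemma card_inter_lt_card {s t : Finset α} {x : α} (hx : x ∈ s) (hxt : x ∉ t) :
    (s ∩ t).card < s.card :=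
  Finset.card_lt_card ⟨Finset.inter_subset_left, fun h => hxt (Finset.mem_inter.1 (h hx)).2⟩

lemma PathOff.card_inter_cover {p : ℕ → Finset α} {t : ℕ} (hp : PathOff E U p t)
    (h0 : (p 0 ∩ U).card = 1) {i : ℕ} (hi : i ≤ t) : (p i ∩ cover U p i).card = 1 := by
  rcases i with _ | i
  · simpa [cover_zero] using h0
  · obtain ⟨x, hx, -⟩ := hp.step i (by omega)
    simp [hx]

/-- If an edge `g` meets the union of a sequence in one vertex and, by another vertex, a path off
that union, then following the path leads to a step with at least two common vertices. -/
lemma Grow.gain_of_return {p : ℕ → Finset α} {t m : ℕ} {g : Finset α} {x : α} (hk : 3 ≤ k)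
    (hu : ∀ e ∈ E, e.card = k) (hp : PathOff E U p t) (h0 : (p 0 ∩ U).card = 1)
    (h : Grow E k j a b l (cover U p m) e) (hm : m ≤ t) (hg : g ∈ E)
    (hgx : g ∩ p t = {x}) (hx : x ∉ cover U p t) (hc : (g ∩ cover U p m).card = 1) :
    ∃ j' ≤ j + 3, ∃ l' ≤ l + 2 + t, ∃ U' e', Grow E k j' a (b + 1) l' U' e' := by
  have hxg : x ∈ g ∧ x ∈ p t := Finset.mem_inter.1 (hgx ▸ Finset.mem_singleton_self x)
  have hxm : ∀ i ≤ t, x ∉ cover U p i := fun i hi h => hx (cover_mono p hi h)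
  -- Attach `g` after the first `m` path edges and resume the path. The step sought is the first
  -- path edge that meets `g` outside what was present before `g`.
  have hex : ∃ i, m ≤ i ∧ (p i ∩ (g \ cover U p m)).Nonempty :=
    ⟨t, hm, x, by simp [hxg, hxm m hm]⟩
  classical
  obtain ⟨hm', hne⟩ := Nat.find_spec hex
  have hmin : ∀ i, m ≤ i → i < Nat.find hex → p i ∩ (g \ cover U p m) = ∅ := fun i hi hlt => by
    by_contra hne
    exact Nat.find_min hex hlt ⟨hi, Finset.nonempty_iff_ne_empty.2 hne⟩
  have hle : Nat.find hex ≤ t := Nat.find_le ⟨hm, x, by simp [hxg, hxm m hm]⟩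
  generalize Nat.find hex = m' at hm' hne hmin hle
  have hsame : ∀ i, m ≤ i → i < m' → p i ∩ (cover U p i ∪ g) = p i ∩ cover U p i := by
    intro i hi hlt
    ext y
    have := Finset.eq_empty_iff_forall_notMem.1 (hmin i hi hlt) y
    have h2 := @cover_mono _ _ U p m i hi y
    simp only [Finset.mem_inter, Finset.mem_union, Finset.mem_sdiff] at *
    tauto
  have hcov : ∀ i, cover U p (i + 1) ∪ g = cover U p i ∪ g ∪ p i := fun i => by
    rw [cover_succ]; ac_rfl
  have hg1 := h.jump hg hc
  have key : ∃ j' ≤ j + 2, ∃ e', Grow E k j' a b (l + 1 + (m' - m)) (cover U p m' ∪ g) e' := by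
    rcases hm'.eq_or_lt with rfl | hlt
    · exact ⟨j + 1, by omega, g, by simpa using hg1⟩
    refine ⟨j + 2, le_rfl, p (m' - 1), ?_⟩
    have : ∀ i, m + 1 ≤ i → i ≤ m' →
        Grow E k (j + 2) a b (l + 1 + (i - m)) (cover U p i ∪ g) (p (i - 1)) := by
      intro i hi
      induction i, hi using Nat.le_induction with
      | base =>
        intro _
        have h1 := hg1.jump (hp.mem m hm)
          (by rw [hsame m le_rfl hlt]; exact hp.card_inter_cover h0 hm)
        rw [hcov]
        simpa using h1
      | succ i hi ih =>
        intro him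
        have hpi := hp.card_inter_cover h0 (i := i) (by omega)
        have h1 := (ih (by omega)).run (f := p i) (hp.mem i (by omega))
          (by rw [hsame i (by omega) (by omega)]; exact hpi) (by
            obtain ⟨y, hy, hyi, -⟩ := hp.step (i - 1) (by omega)
            rw [show i - 1 + 1 = i by omega] at hy
            exact ⟨y, Finset.mem_inter.2
              ⟨(Finset.mem_inter.1 (hy ▸ Finset.mem_singleton_self y)).1, hyi⟩⟩)
        rw [hcov, show l + 1 + (i + 1 - m) = l + 1 + (i - m) + 1 by omega]
        exact h1
    exact this m' hlt le_rfl
  obtain ⟨j', hj', e', hG⟩ := key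
  have hdisj : Disjoint (p m' ∩ cover U p m') (p m' ∩ (g \ cover U p m)) := by
    rw [Finset.disjoint_left]
    intro y hy hy'
    simp only [Finset.mem_inter, Finset.mem_sdiff] at hy hy'
    rcases mem_cover.1 hy.2 with h | ⟨i, hi, h⟩
    · exact hy'.2.2 (mem_cover.2 (.inl h))
    · rcases Nat.lt_or_ge i m with him | him
      · exact hy'.2.2 (mem_cover.2 (.inr ⟨i, him, h⟩))
      · have := Finset.eq_empty_iff_forall_notMem.1 (hmin i him hi) y
        simp only [Finset.mem_inter, Finset.mem_sdiff] at this
        tauto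
  have hsplit : p m' ∩ (cover U p m' ∪ g) =
      (p m' ∩ cover U p m') ∪ (p m' ∩ (g \ cover U p m)) := by
    ext y
    have h2 := @cover_mono _ _ U p m m' hm' y
    simp only [Finset.mem_inter, Finset.mem_union, Finset.mem_sdiff]
    tauto
  have hcard : (p m' ∩ (cover U p m' ∪ g)).card = 1 + (p m' ∩ (g \ cover U p m)).card := by
    rw [hsplit, Finset.card_union_of_disjoint hdisj, hp.card_inter_cover h0 hle]
  -- The returning edge is not swallowed. If it is the last edge, it meets `g` only in `x`, and `k ≥
  -- 3` suffices. Otherwise it misses `x`, hence contains at most `k - 2` of the new vertices of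
  -- `g`.
  have hub : (p m' ∩ (g \ cover U p m)).card + 1 < k := by
    rcases hle.eq_or_lt with rfl | hlt
    · have : (p m' ∩ (g \ cover U p m)).card ≤ ({x} : Finset α).card := by
        rw [← hgx, Finset.inter_comm g]
        exact Finset.card_le_card (Finset.inter_subset_inter_left Finset.sdiff_subset)
      simp only [Finset.card_singleton] at this
      omega
    · have hxm' : x ∉ p m' := fun h => hx (mem_cover.2 (.inr ⟨m', hlt, h⟩))
      have h1 := card_inter_lt_card (s := g \ cover U p m) (t := p m')
        (by simp [hxg, hxm m hm]) hxm'
      have h2 := Finset.card_sdiff_add_card_inter g (cover U p m)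
      have h3 := hu g hg
      rw [Finset.inter_comm] at h1
      omega
  have := Finset.card_pos.2 hne
  exact ⟨j' + 1, by omega, _, by omega, _, _,
    hG.gain (hp.mem m' hle) (by omega) (by omega)⟩

/-- If some edge leaves the union of a sequence, then the sequence extends to one with an
additional step with at least two common vertices. -/
lemma Grow.exists_gain (hk : 3 ≤ k) (hE : Critical E k) (hT : ∀ U e, ¬ Grow E k 0 0 0 T U e)
    (h : Grow E k j a b l U e) (hf : f ∈ E) (hmeet : (f ∩ U).Nonempty) (hns : ¬ f ⊆ U) :
    ∃ j' ≤ j + 4, ∃ l' ≤ l + 2 * T + 2, ∃ U' e', Grow E k j' a (b + 1) l' U' e' := by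
  obtain ⟨y, hyf, hyU⟩ := Finset.not_subset.1 hns
  have hlt := card_inter_lt_card hyf hyU
  rw [hE.uniform f hf] at hlt
  rcases Nat.lt_or_ge 1 (f ∩ U).card with h2 | h1
  · exact ⟨j + 1, by omega, l + 1, by omega, _, _, h.gain hf h2 hlt⟩
  obtain ⟨p, t, htT, hp0, hp, hmax⟩ := exists_maximal_path hE hT hf U
  have h0 : (p 0 ∩ U).card = 1 := by
    rw [hp0]; exact le_antisymm h1 (Finset.card_pos.2 hmeet)
  have hpt := hp.card_inter_cover h0 le_rfl
  obtain ⟨x, hx, hxc⟩ : ∃ x ∈ p t, x ∉ cover U p t := by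
    by_contra! hc
    rw [Finset.inter_eq_left.2 hc, hE.uniform _ (hp.mem t le_rfl)] at hpt
    omega
  obtain ⟨g, hg, hgx, hne⟩ := hmax x hx hxc
  classical
  -- Only the path edges needed for `g` to touch the union are added before `g`; either `g` then
  -- gains at once, or it touches in one vertex and the rest of the path returns to it.
  have hex : ∃ m, (g ∩ cover U p m).Nonempty := ⟨t, hne⟩
  have hm := Nat.find_spec hex
  have hmt : Nat.find hex ≤ t := Nat.find_le hne
  generalize Nat.find hex = m at hm hmt
  obtain ⟨j', hj', e', hG⟩ := h.append_path hp h0 (m := m) (by omega)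
  have hxg : x ∈ g := (Finset.mem_inter.1 (hgx ▸ Finset.mem_singleton_self x)).1
  have hlt := card_inter_lt_card hxg (fun h => hxc (cover_mono p hmt h))
  rw [hE.uniform g hg] at hlt
  have hpos := Finset.card_pos.2 hm
  rcases Nat.lt_or_ge 1 (g ∩ cover U p m).card with h2 | h1
  · exact ⟨j' + 1, by omega, _, by omega, _, _, hG.gain hg h2 hlt⟩
  · obtain ⟨j'', hj'', l', hl', h⟩ := hG.gain_of_return hk hE.uniform hp h0 hmt hg hgx hxc
      (by omega)
    exact ⟨j'', by omega, l', by omega, h⟩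

end Hypergraph

/-! ### Cycles closed at the end of a path, and the structure theorem. -/

section Hypergraph

variable {α : Type*} [DecidableEq α] {E : Set (Finset α)} {k j a b l T : ℕ} {U e f : Finset α}

/-- Allows the part of a path before the point where a cycle closes to be discarded. -/
lemma PathOff.shift {p : ℕ → Finset α} {t i : ℕ} (hp : PathOff E ∅ p t) (hi : i ≤ t) :
    PathOff E ∅ (fun s => p (i + s)) (t - i) := by
  refine ⟨fun s hs => hp.mem _ (by omega), fun s hs => ?_⟩
  obtain ⟨x, hx, hxi, hxc⟩ := hp.step (i + s) (by omega)
  have hsub : ∀ s, cover ∅ (fun s => p (i + s)) s ⊆ cover ∅ p (i + s) := by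
    intro s y hy
    rw [mem_cover] at hy ⊢
    rcases hy with h | ⟨c, hc, h⟩
    · exact .inl h
    · exact .inr ⟨i + c, by omega, h⟩
  refine ⟨x, Finset.Subset.antisymm ?_ ?_, hxi, fun h => hxc (hsub s h)⟩
  · rw [← hx]
    exact Finset.inter_subset_inter_left (hsub (s + 1))
  · have := Finset.mem_inter.1 (hx ▸ Finset.mem_singleton_self x)
    exact Finset.singleton_subset_iff.2 (Finset.mem_inter.2
      ⟨this.1, mem_cover.2 (.inr ⟨s, by omega, hxi⟩)⟩)

/-- A path whose end is linked by an edge `f` to its start, which `f` meets in several vertices. -/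
lemma PathOff.grow_of_spoiled {p : ℕ → Finset α} {t : ℕ} {v : α} (hp : PathOff E ∅ p t)
    (hu : ∀ e ∈ E, e.card = k) (ht : 1 ≤ t) (hf : f ∈ E) (hv : v ∉ cover ∅ p t)
    (hfv : f ∩ p t = {v}) (hmid : ∀ s, 0 < s → s < t → f ∩ p s = ∅)
    (h2 : 2 ≤ (f ∩ p 0).card) :
    ∃ j ≤ 3, ∃ U e, Grow E k j 1 1 (t + 1) U e := by
  have hvm := Finset.mem_inter.1 (hfv ▸ Finset.mem_singleton_self v)
  have hlt : (f ∩ p 0).card < k := by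
    rw [← hu f hf]
    exact card_inter_lt_card hvm.1 (fun h => hv (mem_cover.2 (.inr ⟨0, ht, h⟩)))
  have hcov : ∀ s, cover f p s = f ∪ cover ∅ p s := fun s => by simp [cover]
  have hstep : ∀ s, 0 < s → s < t →
      (p s ∩ cover f p s).card = 1 ∧ (p s ∩ p (s - 1)).Nonempty := by
    intro s hs hst
    obtain ⟨x, hx, hxi, -⟩ := hp.step (s - 1) (by omega)
    rw [show s - 1 + 1 = s by omega] at hx
    rw [hcov, Finset.inter_union_distrib_left, Finset.inter_comm, hmid s hs hst, hx]
    exact ⟨by simp, x, Finset.mem_inter.2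
      ⟨(Finset.mem_inter.1 (hx ▸ Finset.mem_singleton_self x)).1, hxi⟩⟩
  -- With `f` attached early, the last edge meets the rest both in its link to the preceding edge
  -- and in `v`, and these differ because `v` is new.
  have hlast : (p t ∩ cover f p t).card = 2 := by
    obtain ⟨x, hx, hxi, -⟩ := hp.step (t - 1) (by omega)
    rw [show t - 1 + 1 = t by omega] at hx
    rw [hcov, Finset.inter_union_distrib_left, Finset.inter_comm, hfv, hx]
    refine Finset.card_pair ?_
    rintro rfl
    exact hv (Finset.mem_inter.1 (hx ▸ Finset.mem_singleton_self v)).2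
  have h1 : Grow E k 1 0 1 1 (cover f p 1) f := by
    have := (Grow.start (k := k) (hp.mem 0 (by omega))).gain hf h2 hlt
    simpa [cover, Finset.union_comm] using this
  have key : ∃ j ≤ 2, ∃ e, Grow E k j 0 1 t (cover f p t) e := by
    rcases ht.eq_or_lt with rfl | ht2
    · exact ⟨1, by omega, f, h1⟩
    have : ∀ s, 2 ≤ s → s ≤ t → Grow E k 2 0 1 s (cover f p s) (p (s - 1)) := by
      intro s hs
      induction s, hs using Nat.le_induction with
      | base =>
        intro h
        have := h1.jump (hp.mem 1 (by omega)) (hstep 1 (by omega) (by omega)).1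
        rwa [← cover_succ] at this
      | succ s hs ih =>
        intro h
        have hs' := hstep s (by omega) (by omega)
        have := (ih (by omega)).run (hp.mem s (by omega)) hs'.1 hs'.2
        rwa [← cover_succ] at this
    exact ⟨2, le_rfl, _, this t ht2 le_rfl⟩
  obtain ⟨j, hj, e, hG⟩ := key
  exact ⟨j + 1, by omega, _, _, hG.two (hp.mem t le_rfl) hlast⟩

/-- An edge linking the end of a path back to it closes a cycle, which is simple unless a richer
structure arises. -/
lemma PathOff.exists_cycle {p : ℕ → Finset α} {t : ℕ} {v : α} (hp : PathOff E ∅ p t)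
    (hu : ∀ e ∈ E, e.card = k) (hf : f ∈ E) (hv : v ∉ cover ∅ p t)
    (hfv : f ∩ p t = {v}) (hne : (f ∩ cover ∅ p t).Nonempty) :
    (∃ j ≤ 3, ∃ l ≤ t + 1, ∃ U e, Grow E k j 1 1 l U e) ∨
    ∃ i < t, ∃ y ∈ p i, y ≠ v ∧ f ∩ (Finset.Icc i t).biUnion p = {v, y} ∧
      Grow E k 1 1 0 (t - i + 1) ((Finset.Icc i t).biUnion p ∪ f) f := by
  classical
  obtain ⟨x, hx⟩ := hne
  rw [Finset.mem_inter, mem_cover] at hx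
  obtain ⟨hxf, h | ⟨i₀, hi₀, hxi⟩⟩ := hx
  · simp at h
  -- The last edge before `p t` that `f` touches: no edge strictly in between is met, so the cycle
  -- is closed by exactly these two edges.
  have hi := Nat.findGreatest_spec (P := fun i => (f ∩ p i).Nonempty) (m := i₀) (n := t - 1)
    (by omega) ⟨x, Finset.mem_inter.2 ⟨hxf, hxi⟩⟩
  have hmax : ∀ s, Nat.findGreatest (fun i => (f ∩ p i).Nonempty) (t - 1) < s → s < t →
      f ∩ p s = ∅ := fun s h1 h2 => by
    simpa using Nat.findGreatest_is_greatest h1 (by omega)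
  have hle := Nat.findGreatest_le (P := fun i => (f ∩ p i).Nonempty) (t - 1)
  generalize Nat.findGreatest (fun i => (f ∩ p i).Nonempty) (t - 1) = i at hi hmax hle
  have hit : i < t := by omega
  have hvi : v ∉ p i := fun h => hv (mem_cover.2 (.inr ⟨i, hit, h⟩))
  rcases Nat.lt_or_ge 1 (f ∩ p i).card with h2 | h1
  · left
    obtain ⟨j, hj, U, e, h⟩ := (hp.shift hit.le).grow_of_spoiled hu (f := f) (v := v) (by omega) hf
      (fun h => hv (by
        rw [mem_cover] at h ⊢
        rcases h with h | ⟨c, hc, h⟩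
        · exact .inl h
        · exact .inr ⟨i + c, by omega, h⟩))
      (by simpa [Nat.add_sub_cancel' hit.le] using hfv)
      (fun s hs hst => hmax _ (by omega) (by omega)) h2
    exact ⟨j, hj, _, by omega, U, e, h⟩
  · right
    obtain ⟨y, hy⟩ := Finset.card_eq_one.1 (le_antisymm h1 (Finset.card_pos.2 hi))
    have hym := Finset.mem_inter.1 (hy ▸ Finset.mem_singleton_self y)
    have hyv : y ≠ v := by rintro rfl; exact hvi hym.2
    have hint : f ∩ (Finset.Icc i t).biUnion p = {v, y} := by
      ext w
      simp only [Finset.mem_inter, Finset.mem_biUnion, Finset.mem_Icc, Finset.mem_insert,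
        Finset.mem_singleton]
      have hvw := Finset.ext_iff.1 hfv w
      have hyw := Finset.ext_iff.1 hy w
      simp only [Finset.mem_inter, Finset.mem_singleton] at hvw hyw
      constructor
      · rintro ⟨hwf, s, ⟨h1, h2⟩, hws⟩
        rcases h1.eq_or_lt with rfl | h1
        · exact .inr (hyw.1 ⟨hwf, hws⟩)
        · rcases h2.eq_or_lt with rfl | h2
          · exact .inl (hvw.1 ⟨hwf, hws⟩)
          · exact absurd (Finset.mem_inter.2 ⟨hwf, hws⟩) (by simp [hmax s h1 h2])
      · rintro (h | h)
        · exact ⟨(hvw.2 h).1, t, by omega, (hvw.2 h).2⟩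
        · exact ⟨(hyw.2 h).1, i, by omega, (hyw.2 h).2⟩
    refine ⟨i, hit, y, hym.2, hyv, hint, ?_⟩
    exact (hp.grow hit.le le_rfl).two hf (by rw [hint]; exact Finset.card_pair hyv.symm)

set_option maxHeartbeats 1000000 in
/-- A critical hypergraph contains a long path or a sequence with two steps that have at least two
common vertices with the preceding ones, one of them exactly two. -/
theorem Critical.exists_grow (hk : 3 ≤ k) (hE : Critical E k)
    (hT : ∀ U e, ¬ Grow E k 0 0 0 T U e) :
    ∃ j ≤ 5, ∃ l ≤ 3 * T + 3, ∃ U e, Grow E k j 1 1 l U e := by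
  by_contra hno
  have hno' : ∀ j ≤ 5, ∀ l ≤ 3 * T + 3, ∀ U e, ¬ Grow E k j 1 1 l U e :=
    fun j hj l hl U e h => hno ⟨j, hj, l, hl, U, e, h⟩
  have hT1 : 1 ≤ T := by
    by_contra h
    obtain ⟨e, he⟩ := hE.nonempty
    obtain rfl : T = 0 := by omega
    exact hT _ _ (.start he)
  -- Without a second gain, the vertex set of a cycle is a union of components.
  have hcl : ∀ l ≤ T + 1, ∀ U e, Grow E k 1 1 0 l U e → ∀ f ∈ E, f ⊆ U ∨ Disjoint f U := by
    intro l hl U e h f hf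
    by_contra! hc
    obtain ⟨j', hj', l', hl', U', e', h'⟩ := h.exists_gain hk hE hT hf
      (Finset.not_disjoint_iff_nonempty_inter.1 hc.2) hc.1
    exact hno' j' hj' l' (by omega) U' e' h'
  -- Hence cycles sharing a vertex have the same vertex set and, by counting vertices, the same
  -- length.
  have huniq : ∀ l₁ ≤ T + 1, ∀ l₂ ≤ T + 1, ∀ U₁ U₂ e₁ e₂, Grow E k 1 1 0 l₁ U₁ e₁ →
      Grow E k 1 1 0 l₂ U₂ e₂ → ∀ x ∈ U₁, x ∈ U₂ → U₁ = U₂ ∧ l₁ = l₂ := by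
    intro l₁ hl₁ l₂ hl₂ U₁ U₂ e₁ e₂ h₁ h₂ x hx₁ hx₂
    have hU : U₁ = U₂ := by
      apply Finset.Subset.antisymm
      · exact (h₁.subset_or_disjoint (hcl _ hl₂ _ _ h₂)).resolve_right
          (Finset.not_disjoint_iff.2 ⟨x, hx₁, hx₂⟩)
      · exact (h₂.subset_or_disjoint (hcl _ hl₁ _ _ h₁)).resolve_right
          (Finset.not_disjoint_iff.2 ⟨x, hx₂, hx₁⟩)
    refine ⟨hU, ?_⟩
    have c₁ := h₁.card_eq (by omega) hE.uniform rfl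
    have c₂ := h₂.card_eq (by omega) hE.uniform rfl
    rw [hU] at c₁
    exact Nat.eq_of_mul_eq_mul_right (by omega : 0 < k - 1) (by omega)
  obtain ⟨e, he⟩ := hE.nonempty
  obtain ⟨p, t, htT, -, hp, hmax⟩ := exists_maximal_path hE hT he ∅
  have hptk := hE.uniform _ (hp.mem t le_rfl)
  have ht : 1 ≤ t := by
    by_contra h
    obtain rfl : t = 0 := by omega
    obtain ⟨v, hv⟩ := Finset.card_pos.1 (by omega : 0 < (p 0).card)
    obtain ⟨f, -, -, hne⟩ := hmax v hv (by simp [cover])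
    simp [cover] at hne
  obtain ⟨u, hu, hup, -⟩ := hp.step (t - 1) (by omega)
  rw [Nat.sub_add_cancel ht] at hu
  have hum := Finset.mem_inter.1 (hu ▸ Finset.mem_singleton_self u)
  -- The last edge has `k - 1 ≥ 2` new vertices; each of the two chosen here is linked back and
  -- closes a cycle.
  obtain ⟨v, hv, v', hv', hvv⟩ := Finset.one_lt_card.1
    (by rw [Finset.card_sdiff, Finset.inter_comm, hu]; simp; omega : 1 < (p t \ cover ∅ p t).card)
  rw [Finset.mem_sdiff] at hv hv'
  obtain ⟨f, hf, hfv, hfne⟩ := hmax v hv.1 hv.2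
  obtain ⟨f', hf', hfv', hfne'⟩ := hmax v' hv'.1 hv'.2
  obtain ⟨i, hi, y, hyi, hyv, hfP, hG⟩ := (hp.exists_cycle hE.uniform hf hv.2 hfv hfne).resolve_left
    (fun ⟨j, hj, l, hl, U, e, h⟩ => hno' j (by omega) l (by omega) U e h)
  obtain ⟨i', hi', y', hyi', hyv', hfP', hG'⟩ :=
    (hp.exists_cycle hE.uniform hf' hv'.2 hfv' hfne').resolve_left
    (fun ⟨j, hj, l, hl, U, e, h⟩ => hno' j (by omega) l (by omega) U e h)
  have hmemP : ∀ i ≤ t, ∀ w ∈ p t, w ∈ (Finset.Icc i t).biUnion p := fun i hi w hw =>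
    Finset.mem_biUnion.2 ⟨t, by simp [hi], hw⟩
  obtain ⟨hUU, hll⟩ := huniq _ (by omega) _ (by omega) _ _ _ _ hG hG' v
    (Finset.mem_union_left _ (hmemP i hi.le v hv.1))
    (Finset.mem_union_left _ (hmemP i' hi'.le v hv.1))
  obtain rfl : i = i' := by omega
  have hyP : ∀ y ∈ p i, y ∈ (Finset.Icc i t).biUnion p := fun y hy =>
    Finset.mem_biUnion.2 ⟨i, by simp [hi.le], hy⟩
  have hptP := hmemP i hi.le
  generalize (Finset.Icc i t).biUnion p = P at *
  have hvf : v ∈ f := (Finset.mem_inter.1 (hfv ▸ Finset.mem_singleton_self v)).1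
  have hvf' : v' ∈ f' := (Finset.mem_inter.1 (hfv' ▸ Finset.mem_singleton_self v')).1
  have hv'f : v' ∉ f := fun h => hvv (by
    have : v' ∈ f ∩ p t := Finset.mem_inter.2 ⟨h, hv'.1⟩
    rw [hfv, Finset.mem_singleton] at this; exact this.symm)
  have hvf'n : v ∉ f' := fun h => hvv (by
    have : v ∈ f' ∩ p t := Finset.mem_inter.2 ⟨h, hv.1⟩
    rwa [hfv', Finset.mem_singleton] at this)
  have hptff : p t ∩ (f ∪ f') = {v, v'} := by
    rw [Finset.inter_union_distrib_left, Finset.inter_comm, hfv, Finset.inter_comm, hfv']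
    rfl
  -- Both cycles have the same vertex set, so the `k - 2` vertices of `f` off the path must lie in
  -- `f'`.
  have hsd : f \ P ⊆ f' ∩ f := by
    intro w hw
    rw [Finset.mem_sdiff] at hw
    have : w ∈ P ∪ f' := hUU ▸ Finset.mem_union_right _ hw.1
    exact Finset.mem_inter.2 ⟨(Finset.mem_union.1 this).resolve_left hw.2, hw.1⟩
  have hsdc : (f \ P).card + 2 = k := by
    rw [← hE.uniform f hf, ← Finset.card_sdiff_add_card_inter f P, hfP, Finset.card_pair hyv.symm]
  -- Two common vertices would make `f'` a gain over `f`, after which `p t` meets their union in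
  -- exactly `v` and `v'`.
  have hff1 : (f' ∩ f).card ≤ 1 := by
    by_contra hc
    have hlt := card_inter_lt_card hvf' hv'f
    rw [hE.uniform f' hf'] at hlt
    exact hno' 2 (by omega) 2 (by omega) _ _
      (((Grow.start hf).gain hf' (by omega) hlt).two (hp.mem t le_rfl)
        (by rw [hptff]; exact Finset.card_pair hvv))
  have hk3 : k = 3 := by
    have := Finset.card_le_card hsd
    omega
  subst hk3
  obtain ⟨z, hz⟩ := Finset.card_eq_one.1 (by omega : (f \ P).card = 1)
  have hff : f' ∩ f = {z} := by
    rw [hz] at hsd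
    exact (Finset.eq_of_subset_of_card_le hsd (by simpa using hff1)).symm
  have hzm := Finset.mem_sdiff.1 (hz ▸ Finset.mem_singleton_self z)
  -- The triangle `f`, `f'`, `p t` is itself a cycle, of length index 2. Uniqueness shortens the
  -- original cycle to match, so `i = t - 1`.
  have htri : Grow E 3 1 1 0 2 (f ∪ f' ∪ p t) (p t) :=
    ((Grow.start hf).run hf' (by simp [hff]) ⟨z, by simp [hff]⟩).two (hp.mem t le_rfl)
      (by rw [hptff]; exact Finset.card_pair hvv)
  obtain ⟨hUV, hl2⟩ := huniq _ (by omega) _ (by omega) _ _ _ _ hG htri v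
    (Finset.mem_union_left _ (hptP v hv.1)) (Finset.mem_union_right _ hv.1)
  have hit : i = t - 1 := by omega
  have hpt : p t = {u, v, v'} := by
    symm
    apply Finset.eq_of_subset_of_card_le
    · simp [Finset.insert_subset_iff, hum.1, hv.1, hv'.1]
    · rw [hptk, Finset.card_eq_three.2 ⟨u, v, v', ?_, ?_, hvv, rfl⟩]
      · rintro rfl; exact hv.2 hum.2
      · rintro rfl; exact hv'.2 hum.2
  have hfy : ∀ w ∈ f, w = v ∨ w = y ∨ w = z := by
    intro w hw
    by_cases hwP : w ∈ P
    · have : w ∈ f ∩ P := Finset.mem_inter.2 ⟨hw, hwP⟩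
      rw [hfP, Finset.mem_insert, Finset.mem_singleton] at this
      exact this.imp_right .inl
    · have : w ∈ f \ P := Finset.mem_sdiff.2 ⟨hw, hwP⟩
      rw [hz, Finset.mem_singleton] at this
      exact .inr (.inr this)
  have hfy' : ∀ w ∈ f', w = v' ∨ w = y' ∨ w = z := by
    intro w hw
    by_cases hwP : w ∈ P
    · have : w ∈ f' ∩ P := Finset.mem_inter.2 ⟨hw, hwP⟩
      rw [hfP', Finset.mem_insert, Finset.mem_singleton] at this
      exact this.imp_right .inl
    · have h1 : w ∈ P ∪ f := hUU ▸ Finset.mem_union_right _ hw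
      have : w ∈ f \ P := Finset.mem_sdiff.2 ⟨(Finset.mem_union.1 h1).resolve_left hwP, hwP⟩
      rw [hz, Finset.mem_singleton] at this
      exact .inr (.inr this)
  have hyy : y ≠ y' := by
    rintro rfl
    have h1 : y ∈ f ∩ P := by simp [hfP]
    have h2 : y ∈ f' ∩ P := by simp [hfP']
    have h3 : y ∈ f' ∩ f := Finset.mem_inter.2
      ⟨(Finset.mem_inter.1 h2).1, (Finset.mem_inter.1 h1).1⟩
    rw [hff, Finset.mem_singleton] at h3
    exact hzm.2 (h3 ▸ hyP y hyi)
  have hVcl := hcl _ (by omega) _ _ htri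
  -- The edges `p t`, `p i`, `f`, `f'` form the Pasch configuration on `u, v, v', y, y', z`. The
  -- class `{z, u}` splits all four, so another edge `h` is monochromatic; having three vertices, it
  -- must avoid `{z, u}`.
  obtain ⟨h, hh, hhV, hR⟩ := hE.closed (f ∪ f' ∪ p t) hVcl
    ⟨p t, hp.mem t le_rfl, Finset.subset_union_right⟩ {z, u}
  have hh3 := hE.uniform h hh
  have hRd : Disjoint h {z, u} := hR.resolve_left fun hs => by
    have := Finset.card_le_card hs
    have := Finset.card_le_two (a := z) (b := u)
    omega
  have huh : u ∉ h := fun h' => Finset.disjoint_left.1 hRd h' (by simp)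
  have hzh : z ∉ h := fun h' => Finset.disjoint_left.1 hRd h' (by simp)
  have hh4 : ∀ w ∈ h, w = v ∨ w = v' ∨ w = y ∨ w = y' := by
    intro w hw
    have := hhV hw
    simp only [Finset.mem_union] at this
    rcases this with (h1 | h1) | h1
    · rcases hfy w h1 with h | h | h
      · exact .inl h
      · exact .inr (.inr (.inl h))
      · exact absurd (h ▸ hw) hzh
    · rcases hfy' w h1 with h | h | h
      · exact .inr (.inl h)
      · exact .inr (.inr (.inr h))
      · exact absurd (h ▸ hw) hzh
    · rw [hpt] at h1
      simp only [Finset.mem_insert, Finset.mem_singleton] at h1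
      rcases h1 with h | h | h
      · exact absurd (h ▸ hw) huh
      · exact .inl h
      · exact .inr (.inl h)
  -- An edge through `u` sharing two vertices with `h` forms with it a cycle of length index 1,
  -- contradicting uniqueness against the triangle.
  have hbad : ∀ q ∈ E, u ∈ q → ∀ w₁ w₂, w₁ ≠ w₂ → w₁ ∈ q → w₂ ∈ q → w₁ ∈ h → w₂ ∈ h →
      w₁ ∈ f ∪ f' ∪ p t → False := by
    intro q hq huq w₁ w₂ hne h1 h2 h3 h4 hw
    have hlt := card_inter_lt_card huq huh
    rw [hE.uniform q hq, Finset.inter_comm] at hlt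
    have hge : 1 < (h ∩ q).card := Finset.one_lt_card.2
      ⟨w₁, by simp [h1, h3], w₂, by simp [h2, h4], hne⟩
    have := huniq _ (by omega) _ (by omega) _ _ _ _
      ((Grow.start hq).two hh (by omega)) htri w₁ (Finset.mem_union_left _ h1) hw
    omega
  by_cases hc : v ∈ h ∧ v' ∈ h
  · exact hbad (p t) (hp.mem t le_rfl) hum.1 v v' hvv hv.1 hv'.1 hc.1 hc.2
      (Finset.mem_union_right _ hv.1)
  by_cases hc' : y ∈ h ∧ y' ∈ h
  · exact hbad (p i) (hp.mem i hi.le) (hit ▸ hup) y y' hyy hyi hyi' hc'.1 hc'.2 (hhV hc'.1)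
  · have : h ⊆ {if v ∈ h then v else v', if y ∈ h then y else y'} := by
      intro w hw
      have := hh4 w hw
      simp only [Finset.mem_insert, Finset.mem_singleton]
      rcases this with rfl | rfl | rfl | rfl
      · simp [hw]
      · left; rw [if_neg (fun h => hc ⟨h, hw⟩)]
      · simp [hw]
      · right; rw [if_neg (fun h => hc' ⟨h, hw⟩)]
    have := Finset.card_le_card this
    have := Finset.card_le_two (a := if v ∈ h then v else v') (b := if y ∈ h then y else y')
    omega

end Hypergraph

/-! ### Extraction of a critical hypergraph from a minimal obstruction. -/

section Hypergraph

variable {α : Type*} [DecidableEq α]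

/-- A family of edges with assigned colours, such that every two-colouring makes some edge
monochromatic in its assigned colour, contains a critical hypergraph. -/
lemma exists_critical {k : ℕ} (hk : 1 ≤ k) (F : Finset (Fin 2 × Finset α))
    (hu : ∀ x ∈ F, x.2.card = k)
    (hF : ∀ χ : α → Fin 2, ∃ x ∈ F, ∀ v ∈ x.2, χ v = x.1) :
    ∃ E : Set (Finset α), (∀ e ∈ E, ∃ i, (i, e) ∈ F) ∧ Critical E k := by
  obtain ⟨F', hle, hmin⟩ := exists_minimal_le_of_wellFoundedLT
    (fun F : Finset (Fin 2 × Finset α) => ∀ χ : α → Fin 2, ∃ x ∈ F, ∀ v ∈ x.2, χ v = x.1) F hF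
  -- By minimality each coloured edge is the unique failure of some colouring.
  have hcol : ∀ x ∈ F', ∃ χ : α → Fin 2, (∀ v ∈ x.2, χ v = x.1) ∧
      ∀ y ∈ F', (∀ v ∈ y.2, χ v = y.1) → y = x := by
    intro x hx
    have h := hmin.not_prop_of_lt (Finset.erase_ssubset hx)
    push Not at h
    obtain ⟨χ, hχ⟩ := h
    have huniq : ∀ y ∈ F', (∀ v ∈ y.2, χ v = y.1) → y = x := by
      intro y hy hyc
      by_contra hne
      obtain ⟨v, hv, hvn⟩ := hχ y (Finset.mem_erase.2 ⟨hne, hy⟩)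
      exact hvn (hyc v hv)
    obtain ⟨y, hy, hyc⟩ := hmin.prop χ
    exact ⟨χ, huniq y hy hyc ▸ hyc, huniq⟩
  refine ⟨{e | ∃ i, (i, e) ∈ F'}, fun e ⟨i, hi⟩ => ⟨i, hle hi⟩, ?_, ?_, ?_, ?_⟩
  · obtain ⟨x, hx, -⟩ := hmin.prop (fun _ => 0)
    exact ⟨x.2, x.1, hx⟩
  · rintro e ⟨i, hi⟩
    exact hu _ (hle hi)
  · rintro e ⟨i, hi⟩ v hv
    obtain ⟨χ, hχ, huniq⟩ := hcol _ hi
    -- Flipping `v` repairs this failure, so a new one appears through `v` in the other colour; the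
    -- remaining vertices of `e` still have colour `i` and are avoided.
    obtain ⟨⟨i', f⟩, hf, hfc⟩ := hmin.prop (Function.update χ v (i + 1))
    simp only at hχ hfc
    have hii : i + 1 ≠ i := by fin_cases i <;> decide
    have hvf : v ∈ f := by
      by_contra hvf
      have := huniq _ hf (fun w hw => by
        rw [← hfc w hw, Function.update_of_ne]
        rintro rfl; exact hvf hw)
      rw [Prod.mk.injEq] at this
      exact hvf (this.2 ▸ hv)
    have hi' : i' = i + 1 := by simpa using (hfc v hvf).symm
    refine ⟨f, ⟨i', hf⟩, Finset.Subset.antisymm (fun w hw => ?_) ?_⟩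
    · rw [Finset.mem_inter] at hw
      rw [Finset.mem_singleton]
      by_contra hwv
      have h1 := hfc w hw.1
      rw [Function.update_of_ne hwv, hχ w hw.2, hi'] at h1
      exact hii h1.symm
    · simp [hvf, hv]
  · rintro U hU ⟨e, ⟨i, hi⟩, heU⟩ R
    obtain ⟨χ, hχ, huniq⟩ := hcol _ hi
    -- Outside `U` the only failure of `χ` has been removed, since that edge lies in `U`. Hence the
    -- new failure lies in `U` and is monochromatic for the partition by `R`.
    obtain ⟨⟨i', f⟩, hf, hfc⟩ := hmin.prop
      (fun w => if w ∈ U then (if w ∈ R then 0 else 1) else χ w)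
    simp only at hfc
    have hfU : f ⊆ U := (hU f ⟨i', hf⟩).resolve_right fun hd => by
      have := huniq _ hf (fun w hw => by
        rw [← hfc w hw, if_neg (Finset.disjoint_left.1 hd hw)])
      rw [Prod.mk.injEq] at this
      obtain ⟨v, hv⟩ := Finset.card_pos.1 (by rw [hu _ (hle hi)]; omega : 0 < (i, e).2.card)
      exact Finset.disjoint_left.1 hd (this.2 ▸ hv) (heU hv)
    refine ⟨f, ⟨i', hf⟩, hfU, ?_⟩
    have hfc' : ∀ w ∈ f, (if w ∈ R then (0 : Fin 2) else 1) = i' := fun w hw => by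
      rw [← hfc w hw, if_pos (hfU hw)]
    by_cases h0 : i' = 0
    · left
      intro w hw
      by_contra hwR
      have := hfc' w hw
      rw [if_neg hwR, h0] at this
      exact absurd this (by decide)
    · right
      rw [Finset.disjoint_left]
      intro w hw hwR
      have := hfc' w hw
      rw [if_pos hwR] at this
      exact h0 this.symm

end Hypergraph

/-! ### Weighted sequences of edges -/

section Weights

variable {α : Type*} [DecidableEq α]

/-- The union of a list of finite sets. -/
def listUnion (L : List (Finset α)) : Finset α := L.foldr (· ∪ ·) ∅

lemma listUnion_cons (e : Finset α) (L : List (Finset α)) :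
    listUnion (e :: L) = e ∪ listUnion L := rfl

/-- The lists of length `m + 1` with members in `E`. -/
def lists (E : Finset (Finset α)) : ℕ → Finset (List (Finset α))
  | 0 => E.image fun e => [e]
  | m + 1 => (E ×ˢ lists E m).image fun x => x.1 :: x.2

/-- The weight of adding `f` to a sequence of `k`-sets with union `U` and last member `e`. -/
def stepWeight (k : ℕ) (s g₂ g₃ : ℝ) (U e f : Finset α) : ℝ :=
  if (f ∩ U).card = 1 ∧ (f ∩ e).Nonempty then 1
  else if (f ∩ U).card = 1 then s
  else if (f ∩ U).card = 2 then s * g₂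
  else if 2 < (f ∩ U).card ∧ (f ∩ U).card < k then s * g₃
  else 0

/-- The product of the weights of the steps of a sequence, which is listed from last to first. -/
def listWeight (k : ℕ) (s g₂ g₃ : ℝ) : List (Finset α) → ℝ
  | [] => 1
  | [_] => 1
  | f :: e :: L => stepWeight k s g₂ g₃ (listUnion (e :: L)) e f * listWeight k s g₂ g₃ (e :: L)

variable {k : ℕ} {s g₂ g₃ : ℝ} {E : Finset (Finset α)}

lemma mem_lists_zero {L : List (Finset α)} : L ∈ lists E 0 ↔ ∃ e ∈ E, [e] = L := by
  simp [lists]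

lemma mem_lists_succ {m : ℕ} {L : List (Finset α)} :
    L ∈ lists E (m + 1) ↔ ∃ e ∈ E, ∃ L' ∈ lists E m, e :: L' = L := by
  simp only [lists, Finset.mem_image, Finset.mem_product, Prod.exists]
  constructor
  · rintro ⟨a, b, ⟨h1, h2⟩, h3⟩; exact ⟨a, h1, b, h2, h3⟩
  · rintro ⟨a, h1, b, h2, h3⟩; exact ⟨a, b, ⟨h1, h2⟩, h3⟩

lemma exists_cons_of_mem_lists {m : ℕ} {L : List (Finset α)} (h : L ∈ lists E m) :
    ∃ e ∈ E, ∃ L', L = e :: L' := by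
  cases m with
  | zero => obtain ⟨e, he, rfl⟩ := mem_lists_zero.1 h; exact ⟨e, he, [], rfl⟩
  | succ m => obtain ⟨e, he, L', -, rfl⟩ := mem_lists_succ.1 h; exact ⟨e, he, L', rfl⟩

lemma card_listUnion_le (hu : ∀ e ∈ E, e.card = k) {m : ℕ} {L : List (Finset α)}
    (h : L ∈ lists E m) : (listUnion L).card ≤ k * (m + 1) := by
  induction m generalizing L with
  | zero =>
    obtain ⟨e, he, rfl⟩ := mem_lists_zero.1 h
    simp [listUnion, hu e he]
  | succ m ih =>
    obtain ⟨e, he, L', hL', rfl⟩ := mem_lists_succ.1 h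
    rw [listUnion_cons]
    have h1 := Finset.card_union_le e (listUnion L')
    have h2 := ih hL'
    have h3 := hu e he
    calc _ ≤ _ := h1
      _ ≤ k + k * (m + 1) := by omega
      _ = _ := by ring

lemma stepWeight_nonneg (hs : 0 ≤ s) (h2 : 0 ≤ g₂) (h3 : 0 ≤ g₃) (U e f : Finset α) :
    0 ≤ stepWeight k s g₂ g₃ U e f := by
  unfold stepWeight; split_ifs <;> positivity

lemma listWeight_nonneg (hs : 0 ≤ s) (h2 : 0 ≤ g₂) (h3 : 0 ≤ g₃) (L : List (Finset α)) :
    0 ≤ listWeight k s g₂ g₃ L := by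
  induction L with
  | nil => simp [listWeight]
  | cons f L ih =>
    cases L with
    | nil => simp [listWeight]
    | cons e L => exact mul_nonneg (stepWeight_nonneg hs h2 h3 _ _ _) ih

/-- A grown sequence has large weight. -/
lemma Grow.exists_list {j a b l : ℕ} {U e : Finset α} (hs : 0 ≤ s) (hs1 : s ≤ 1)
    (h23 : g₃ ≤ g₂) (h3 : 1 ≤ g₃) (h : Grow (E : Set (Finset α)) k j a b l U e) :
    ∃ L, e :: L ∈ lists E l ∧ listUnion (e :: L) = U ∧
      s ^ j * g₂ ^ a * g₃ ^ b ≤ listWeight k s g₂ g₃ (e :: L) := by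
  have h30 : 0 ≤ g₃ := by linarith
  have h20 : 0 ≤ g₂ := by linarith
  have step : ∀ {j a b l j' a' b' : ℕ} {U e f : Finset α} (w : ℝ),
      (∃ L, e :: L ∈ lists E l ∧ listUnion (e :: L) = U ∧
        s ^ j * g₂ ^ a * g₃ ^ b ≤ listWeight k s g₂ g₃ (e :: L)) → f ∈ E →
      w ≤ stepWeight k s g₂ g₃ U e f →
      s ^ j' * g₂ ^ a' * g₃ ^ b' = w * (s ^ j * g₂ ^ a * g₃ ^ b) →
      ∃ L, f :: L ∈ lists E (l + 1) ∧ listUnion (f :: L) = U ∪ f ∧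
        s ^ j' * g₂ ^ a' * g₃ ^ b' ≤ listWeight k s g₂ g₃ (f :: L) := by
    rintro j a b l j' a' b' U e f w ⟨L, hL, rfl, hw⟩ hf hwf heq
    refine ⟨e :: L, mem_lists_succ.2 ⟨f, hf, _, hL, rfl⟩, ?_, ?_⟩
    · rw [listUnion_cons, Finset.union_comm]
    · rw [heq]
      exact mul_le_mul hwf hw (by positivity) (stepWeight_nonneg hs h20 h30 _ _ _)
  induction h with
  | start he => exact ⟨[], mem_lists_zero.2 ⟨_, he, rfl⟩, by simp [listUnion], by simp [listWeight]⟩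
  | run _ hf hc hm ih => exact step 1 ih hf (by simp [stepWeight, hc, hm]) (by ring)
  | jump _ hf hc ih =>
    refine step s ih hf ?_ (by ring)
    -- A jump may happen to meet the last edge and then weighs 1, which is where `s ≤ 1` enters.
    unfold stepWeight
    split_ifs <;> first | exact hs1 | exact le_rfl
  | two _ hf hc ih => exact step (s * g₂) ih hf (by simp [stepWeight, hc]) (by ring)
  | gain _ hf hc hc' ih =>
    refine step (s * g₃) ih hf ?_ (by ring)
    -- A gain with exactly two common vertices is weighted by `g₂`; this needs `g₃ ≤ g₂`.
    unfold stepWeight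
    split_ifs with h1 h2 h3' h4
    · omega
    · omega
    · gcongr
    · exact le_rfl
    · omega

/-- With the tail of the list fixed, the power of `p` splits off the contribution of the new
vertices of the head, so each step multiplies the weighted sum by at most `κ`. -/
lemma sum_lists_le {p M κ : ℝ} (hp : 0 ≤ p) (hs : 0 ≤ s) (h2 : 0 ≤ g₂) (h3 : 0 ≤ g₃) (hκ : 0 ≤ κ)
    (hu : ∀ e ∈ E, e.card = k) (hM : ∑ e ∈ E, p ^ e.card ≤ M) (N : ℕ)
    (hstep : ∀ U e : Finset α, U.card ≤ k * N → e ⊆ U → e ∈ E →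
      ∑ f ∈ E, stepWeight k s g₂ g₃ U e f * p ^ (f \ U).card ≤ κ) {m : ℕ} (hm : m ≤ N) :
    ∑ L ∈ lists E m, listWeight k s g₂ g₃ L * p ^ (listUnion L).card ≤ M * κ ^ m := by
  induction m with
  | zero =>
    rw [lists, Finset.sum_image (by simp)]
    simpa [listWeight, listUnion] using hM
  | succ m ih =>
    rw [lists, Finset.sum_image (by
      rintro ⟨a, b⟩ - ⟨c, d⟩ - h
      simpa using h), Finset.sum_product_right]
    calc _ ≤ ∑ L ∈ lists E m, κ * (listWeight k s g₂ g₃ L * p ^ (listUnion L).card) := by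
          refine Finset.sum_le_sum fun L hL => ?_
          have hcard := card_listUnion_le hu hL
          obtain ⟨e, he, L', rfl⟩ := exists_cons_of_mem_lists hL
          have h1 := hstep (listUnion (e :: L')) e
            (hcard.trans (Nat.mul_le_mul_left _ hm)) Finset.subset_union_left he
          have h4 := mul_le_mul_of_nonneg_right h1 (mul_nonneg
            (listWeight_nonneg (k := k) hs h2 h3 (e :: L'))
            (pow_nonneg hp (listUnion (e :: L')).card))
          refine le_trans (le_of_eq ?_) h4
          rw [Finset.sum_mul]
          refine Finset.sum_congr rfl fun f _ => ?_
          rw [listUnion_cons f, ← Finset.sdiff_union_self_eq_union,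
            Finset.card_union_of_disjoint Finset.sdiff_disjoint, pow_add, listWeight]
          ring
      _ ≤ _ := by
          rw [← Finset.mul_sum, pow_succ]
          have := mul_le_mul_of_nonneg_left (ih (by omega)) hκ
          linarith

end Weights

/-! ### Random sets -/

section Random

variable {ι : Type*}

lemma setBernoulli_real_superset_le (u : Set ι) (p : I) (U : Finset ι) :
    (setBernoulli u p).real {S | (U : Set ι) ⊆ S} ≤ (p : ℝ) ^ U.card := by
  have h : setBernoulli u p {S | (U : Set ι) ⊆ S} ≤ (toNNReal p : ENNReal) ^ U.card := by
    rw [setBernoulli_apply']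
    have : (fun P : ι → Prop => {i | P i}) ⁻¹' {S | (U : Set ι) ⊆ S} =
        Set.pi U (fun _ => {True}) := by
      ext P
      simp [Set.subset_def, Set.mem_pi]
    rw [this, Measure.infinitePi_pi _ (fun _ _ => MeasurableSet.of_discrete)]
    calc _ ≤ ∏ _i ∈ U, (toNNReal p : ENNReal) := by
          refine Finset.prod_le_prod' fun i _ => ?_
          simp only [Measure.add_apply, Measure.smul_apply]
          by_cases hi : i ∈ u <;> simp [hi]
      _ = _ := by simp
  rw [measureReal_def]
  calc _ ≤ ((toNNReal p : ENNReal) ^ U.card).toReal :=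
        ENNReal.toReal_mono (by simp) h
    _ = _ := by simp

/-- First moment bound for the existence of a sequence of large weight. -/
lemma measureReal_exists_list_le {E : Finset (Finset ι)} [DecidableEq ι] {k m : ℕ}
    {s g₂ g₃ lam B : ℝ} (u : Set ι) (p : I) (hs : 0 ≤ s) (h2 : 0 ≤ g₂) (h3 : 0 ≤ g₃)
    (hlam : 0 < lam)
    (hB : ∑ L ∈ lists E m, listWeight k s g₂ g₃ L * (p : ℝ) ^ (listUnion L).card ≤ B) :
    (setBernoulli u p).real {S | ∃ L ∈ lists E m, lam ≤ listWeight k s g₂ g₃ L ∧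
      ((listUnion L : Finset ι) : Set ι) ⊆ S} ≤ B / lam := by
  classical
  have hsub : {S | ∃ L ∈ lists E m, lam ≤ listWeight k s g₂ g₃ L ∧
      ((listUnion L : Finset ι) : Set ι) ⊆ S} ⊆
      ⋃ L ∈ (lists E m).filter (fun L => lam ≤ listWeight k s g₂ g₃ L),
        {S | ((listUnion L : Finset ι) : Set ι) ⊆ S} := by
    rintro S ⟨L, hL, hw, hS⟩
    simp only [Set.mem_iUnion]
    exact ⟨L, Finset.mem_filter.2 ⟨hL, hw⟩, hS⟩
  refine (measureReal_mono hsub (measure_ne_top _ _)).trans ((measureReal_biUnion_finset_le _ _).trans ?_)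
  rw [le_div_iff₀ hlam, Finset.sum_mul]
  refine le_trans ?_ hB
  refine le_trans (Finset.sum_le_sum (g := fun L =>
    listWeight k s g₂ g₃ L * (p : ℝ) ^ (listUnion L).card) fun L hL => ?_) ?_
  · rw [mul_comm]
    exact mul_le_mul (Finset.mem_filter.1 hL).2 (setBernoulli_real_superset_le u p _)
      measureReal_nonneg (listWeight_nonneg hs h2 h3 L)
  · exact Finset.sum_le_sum_of_subset_of_nonneg (Finset.filter_subset _ _) fun L _ _ =>
      mul_nonneg (listWeight_nonneg hs h2 h3 L) (pow_nonneg p.2.1 _)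

end Random

/-! ### Hypergraphs of solutions -/

section Solutions

variable {k : ℕ}

open scoped Classical in
/-- The injective members of `Y` with coordinates in `{1, …, n}`. -/
def solutions (Y : Set (Fin k → ℤ)) (n : ℕ) : Finset (Fin k → ℤ) :=
  (Fintype.piFinset fun _ => Finset.Icc (1 : ℤ) n).filter fun y => Function.Injective y ∧ y ∈ Y

lemma mem_solutions {Y : Set (Fin k → ℤ)} {n : ℕ} {y : Fin k → ℤ} :
    y ∈ solutions Y n ↔ (∀ j, 1 ≤ y j ∧ y j ≤ n) ∧ Function.Injective y ∧ y ∈ Y := by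
  simp [solutions]

/-- The sets of coordinates of the injective members of `Y 0` and `Y 1` in `{1, …, n}`. -/
def edges (Y : Fin 2 → Set (Fin k → ℤ)) (n : ℕ) : Finset (Finset ℤ) :=
  (Finset.univ.sigma fun i => solutions (Y i) n).image fun x => Finset.univ.image x.2

lemma mem_edges {Y : Fin 2 → Set (Fin k → ℤ)} {n : ℕ} {e : Finset ℤ} :
    e ∈ edges Y n ↔ ∃ i, ∃ y ∈ solutions (Y i) n, Finset.univ.image y = e := by
  simp [edges]

lemma card_image_of_mem_solutions {Y : Set (Fin k → ℤ)} {n : ℕ} {y : Fin k → ℤ}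
    (hy : y ∈ solutions Y n) : (Finset.univ.image y).card = k := by
  rw [Finset.card_image_of_injective _ (mem_solutions.1 hy).2.1]; simp

lemma card_of_mem_edges {Y : Fin 2 → Set (Fin k → ℤ)} {n : ℕ} {e : Finset ℤ}
    (he : e ∈ edges Y n) : e.card = k := by
  obtain ⟨i, y, hy, rfl⟩ := mem_edges.1 he
  exact card_image_of_mem_solutions hy

/-- `Y` has few members in a box, also after prescribing some coordinates up to finitely many
choices; `D` and `r W` play the roles of the dimension of `Y` and of its projection to the
coordinates in `W`. -/
structure Sparse (D : ℕ) (r : Finset (Fin k) → ℕ) (Y : Set (Fin k → ℤ)) : Prop where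
  le : ∀ W, r W ≤ D
  one : ∀ W, W.card = 1 → 1 ≤ r W
  two : ∀ W, W.card = 2 → 2 ≤ r W
  balanced : ∀ W, 2 ≤ W.card → W.card < k → (W.card - 1) * (D - 1) + 1 ≤ (k - 1) * (r W - 1)
  count : ∀ n, 1 ≤ n → ∀ (X : Finset ℤ) (W : Finset (Fin k)),
    ((solutions Y n).filter fun y => ∀ j ∈ W, y j ∈ X).card ≤ X.card ^ W.card * n ^ (D - r W)

variable {D : ℕ} {r : Fin 2 → Finset (Fin k) → ℕ} {Y : Fin 2 → Set (Fin k → ℤ)}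

/-- Group the solutions by the set `W` of coordinates that take values in `X`; by injectivity its
size is the number of common vertices. -/
lemma sum_edges_le (hY : ∀ i, Sparse D (r i) (Y i)) {n : ℕ} (hn : 1 ≤ n) (X : Finset ℤ)
    {φ : ℕ → ℝ} (hφ : ∀ w, 0 ≤ φ w) :
    ∑ f ∈ edges Y n, φ (f ∩ X).card ≤
      ∑ i, ∑ W : Finset (Fin k), (X.card : ℝ) ^ W.card * (n : ℝ) ^ (D - r i W) * φ W.card := by
  refine (Finset.sum_image_le_of_nonneg fun _ _ => hφ _).trans ?_
  rw [Finset.sum_sigma]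
  refine Finset.sum_le_sum fun i _ => ?_
  rw [← Finset.sum_fiberwise (solutions (Y i) n) (fun y => Finset.univ.filter fun j => y j ∈ X)]
  refine Finset.sum_le_sum fun W _ => ?_
  have hc : ∀ y ∈ (solutions (Y i) n).filter
      (fun y => (Finset.univ.filter fun j => y j ∈ X) = W),
      φ ((Finset.univ.image y) ∩ X).card = φ W.card := by
    intro y hy
    rw [Finset.mem_filter] at hy
    congr 1
    rw [← hy.2, ← Finset.card_image_of_injective _ (mem_solutions.1 hy.1).2.1]
    congr 1
    ext x
    simp only [Finset.mem_inter, Finset.mem_image, Finset.mem_univ, true_and, Finset.mem_filter]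
    constructor
    · rintro ⟨⟨j, rfl⟩, h⟩; exact ⟨j, h, rfl⟩
    · rintro ⟨j, h, rfl⟩; exact ⟨⟨j, rfl⟩, h⟩
  rw [Finset.sum_congr rfl hc, Finset.sum_const, nsmul_eq_mul]
  refine mul_le_mul_of_nonneg_right ?_ (hφ _)
  have h1 : ((solutions (Y i) n).filter
      (fun y => (Finset.univ.filter fun j => y j ∈ X) = W)).card ≤
      ((solutions (Y i) n).filter fun y => ∀ j ∈ W, y j ∈ X).card := by
    refine Finset.card_le_card fun y hy => ?_
    rw [Finset.mem_filter] at hy ⊢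
    refine ⟨hy.1, fun j hj => ?_⟩
    rw [← hy.2] at hj
    exact (Finset.mem_filter.1 hj).2
  exact_mod_cast h1.trans ((hY i).count n hn X W)

/-- The exponent of the threshold. -/
def expo (k D : ℕ) : ℝ := ((D : ℝ) - 1) / ((k : ℝ) - 1)

variable {n : ℕ} {p : ℝ}

lemma pow_mul_pow_le (hn : 1 ≤ n) (hp0 : 0 ≤ p) {c : ℝ} (hp : p ≤ c * (n : ℝ) ^ (-expo k D))
    (d m : ℕ) :
    (n : ℝ) ^ d * p ^ m ≤ c ^ m * (n : ℝ) ^ ((d : ℝ) - expo k D * m) := by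
  have hn' : (0 : ℝ) < n := by exact_mod_cast hn
  calc (n : ℝ) ^ d * p ^ m ≤ (n : ℝ) ^ d * (c * (n : ℝ) ^ (-expo k D)) ^ m := by gcongr
    _ = c ^ m * ((n : ℝ) ^ (d : ℝ) * (n : ℝ) ^ (-expo k D * m)) := by
        rw [mul_pow, Real.rpow_mul hn'.le, Real.rpow_natCast, Real.rpow_natCast]; ring
    _ = _ := by rw [← Real.rpow_add hn']; congr 2; ring

/-- The factor gained in a step with `w` old vertices. -/
def gainFactor (k D n w : ℕ) : ℝ :=
  if w = 1 then 1 else if w = 2 then (n : ℝ) ^ (1 - expo k D) else (n : ℝ) ^ (1 / ((k : ℝ) - 1))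

/-- The power of `n` in the expected number of extensions is at most θ(|W| - 1) - (r(W) - 1), where
θ = `expo k D`. The gain factor is the inverse of the saving guaranteed by `one`, `two` and
`balanced` respectively. -/
lemma count_mul_gain_le (hD : 2 ≤ D) (hDk : D < k) {r : Finset (Fin k) → ℕ} {Y : Set (Fin k → ℤ)}
    (hY : Sparse D r Y) (hn : 1 ≤ n) (hp0 : 0 ≤ p) {c : ℝ} (hc0 : 0 ≤ c) (hc1 : c ≤ 1)
    (hp : p ≤ c * (n : ℝ) ^ (-expo k D)) {W : Finset (Fin k)} (h1 : 1 ≤ W.card)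
    (hk : W.card < k) :
    (n : ℝ) ^ (D - r W) * (gainFactor k D n W.card * p ^ (k - W.card)) ≤ 1 := by
  have hn' : (1 : ℝ) ≤ n := by exact_mod_cast hn
  have hn0 : (0 : ℝ) < n := by linarith
  have hk1 : (0 : ℝ) < (k : ℝ) - 1 := by
    have : (3 : ℝ) ≤ k := by exact_mod_cast (by omega : 3 ≤ k)
    linarith
  have hexp : expo k D * ((k : ℝ) - 1) = D - 1 := by unfold expo; field_simp
  have hbase := pow_mul_pow_le (k := k) (D := D) hn hp0 hp (D - r W) (k - W.card)
  have hcp : c ^ (k - W.card) ≤ 1 := pow_le_one₀ hc0 hc1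
  have hbase' : (n : ℝ) ^ (D - r W) * p ^ (k - W.card) ≤
      (n : ℝ) ^ (expo k D * ((W.card : ℝ) - 1) - ((r W : ℝ) - 1)) := by
    refine hbase.trans ((mul_le_of_le_one_left (by positivity) hcp).trans (le_of_eq ?_))
    congr 1
    rw [Nat.cast_sub (hY.le W), Nat.cast_sub hk.le]
    linear_combination -hexp
  suffices h : ∃ x : ℝ, gainFactor k D n W.card = (n : ℝ) ^ x ∧
      expo k D * ((W.card : ℝ) - 1) - ((r W : ℝ) - 1) + x ≤ 0 by
    obtain ⟨x, hx, hle⟩ := h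
    calc _ = (n : ℝ) ^ (D - r W) * p ^ (k - W.card) * (n : ℝ) ^ x := by rw [hx]; ring
      _ ≤ (n : ℝ) ^ (expo k D * ((W.card : ℝ) - 1) - ((r W : ℝ) - 1)) * (n : ℝ) ^ x := by gcongr
      _ = (n : ℝ) ^ (expo k D * ((W.card : ℝ) - 1) - ((r W : ℝ) - 1) + x) := by
          rw [Real.rpow_add hn0]
      _ ≤ 1 := Real.rpow_le_one_of_one_le_of_nonpos hn' hle
  unfold gainFactor
  split_ifs with hw1 hw2
  · refine ⟨0, by simp, ?_⟩
    have : (1 : ℝ) ≤ r W := by exact_mod_cast hY.one W hw1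
    rw [hw1]; push_cast; linarith
  · refine ⟨_, rfl, ?_⟩
    have : (2 : ℝ) ≤ r W := by exact_mod_cast hY.two W hw2
    rw [hw2]; push_cast; linarith
  · refine ⟨_, rfl, ?_⟩
    have hb := hY.balanced W (by omega) hk
    have hr1 : 1 ≤ r W := by
      by_contra h0
      rw [show r W - 1 = 0 by omega] at hb
      omega
    have hb' : ((W.card : ℝ) - 1) * (D - 1) + 1 ≤ (k - 1) * ((r W : ℝ) - 1) := by
      have : (((W.card - 1) * (D - 1) + 1 : ℕ) : ℝ) ≤ (((k - 1) * (r W - 1) : ℕ) : ℝ) := by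
        exact_mod_cast hb
      push_cast [Nat.cast_sub h1, Nat.cast_sub (by omega : 1 ≤ D), Nat.cast_sub hr1,
        Nat.cast_sub (by omega : 1 ≤ k)] at this
      exact this
    have : expo k D * ((W.card : ℝ) - 1) + 1 / ((k : ℝ) - 1) ≤ (r W : ℝ) - 1 := by
      rw [expo, div_mul_eq_mul_div, ← add_div, div_le_iff₀ hk1]
      linarith
    linarith

/-- The 1/2 bounds the steps attached to the last edge, where only `k` vertices are available. All
other steps carry a factor `s`, which is later chosen to offset the choices among all earlier
vertices. -/
lemma sum_step_le (hD : 2 ≤ D) (hDk : D < k) (hY : ∀ i, Sparse D (r i) (Y i)) (hn : 1 ≤ n)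
    (hp0 : 0 ≤ p) (hp : p ≤ 1 / (4 * (k : ℝ) ^ 2) * (n : ℝ) ^ (-expo k D)) {s : ℝ} (hs : 0 ≤ s)
    {N : ℕ} {U e : Finset ℤ} (hU : U.card ≤ k * N) (heU : e ⊆ U) (he : e ∈ edges Y n) :
    ∑ f ∈ edges Y n, stepWeight k s (gainFactor k D n 2) (gainFactor k D n 3) U e f *
      p ^ (f \ U).card ≤ 1 / 2 + 2 ^ (k + 1) * ((k : ℝ) * N) ^ k * s := by
  have hk0 : (0 : ℝ) < k := by exact_mod_cast (by omega : 0 < k)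
  have hk1 : (1 : ℝ) ≤ k := by exact_mod_cast (by omega : 1 ≤ k)
  have hc0 : (0 : ℝ) ≤ 1 / (4 * (k : ℝ) ^ 2) := by positivity
  have hc1 : 1 / (4 * (k : ℝ) ^ 2) ≤ 1 := by
    rw [div_le_one (by positivity)]
    nlinarith
  have hg : ∀ w, 0 ≤ gainFactor k D n w := fun w => by
    unfold gainFactor; split_ifs <;> positivity
  have hecard := card_of_mem_edges he
  have hsplit : ∀ f ∈ edges Y n,
      stepWeight k s (gainFactor k D n 2) (gainFactor k D n 3) U e f * p ^ (f \ U).card ≤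
      (if (f ∩ e).card = 1 then p ^ (k - 1) else 0) +
      s * (if 1 ≤ (f ∩ U).card ∧ (f ∩ U).card < k then
        gainFactor k D n (f ∩ U).card * p ^ (k - (f ∩ U).card) else 0) := by
    intro f hf
    have hfc : (f \ U).card = k - (f ∩ U).card := by
      rw [← card_of_mem_edges hf, ← Finset.card_sdiff_add_card_inter f U]; omega
    have hnn1 : (0 : ℝ) ≤ (if (f ∩ e).card = 1 then p ^ (k - 1) else 0) := by
      split_ifs <;> positivity
    have hnn2 : 0 ≤ s * (if 1 ≤ (f ∩ U).card ∧ (f ∩ U).card < k then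
        gainFactor k D n (f ∩ U).card * p ^ (k - (f ∩ U).card) else 0) := by
      refine mul_nonneg hs ?_
      split_ifs
      · exact mul_nonneg (hg _) (by positivity)
      · exact le_rfl
    by_cases hA : (f ∩ U).card = 1 ∧ (f ∩ e).Nonempty
    · have h1 := Finset.card_pos.2 hA.2
      have h2 := Finset.card_le_card (Finset.inter_subset_inter_left heU : f ∩ e ⊆ f ∩ U)
      rw [if_pos (by omega : (f ∩ e).card = 1), stepWeight, if_pos hA, hfc, hA.1]
      rw [hA.1] at hnn2
      linarith
    · by_cases hB : 1 ≤ (f ∩ U).card ∧ (f ∩ U).card < k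
      · have : stepWeight k s (gainFactor k D n 2) (gainFactor k D n 3) U e f =
            s * gainFactor k D n (f ∩ U).card := by
          rw [stepWeight, if_neg hA]
          split_ifs with h1 h2 h3
          · simp [gainFactor, h1]
          · simp [h2]
          · simp [gainFactor, h1, h2]
          · omega
        rw [this, if_pos hB, hfc]
        linarith
      · have : stepWeight k s (gainFactor k D n 2) (gainFactor k D n 3) U e f = 0 := by
          rw [stepWeight, if_neg hA, if_neg (by omega), if_neg (by omega), if_neg (by omega)]
        rw [this, zero_mul]
        exact add_nonneg hnn1 hnn2
  refine (Finset.sum_le_sum hsplit).trans ?_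
  rw [Finset.sum_add_distrib, ← Finset.mul_sum]
  have hS1 := sum_edges_le hY hn e (φ := fun w => if w = 1 then p ^ (k - 1) else 0)
    (fun w => by positivity)
  have hS2 := sum_edges_le hY hn U
    (φ := fun w => if 1 ≤ w ∧ w < k then gainFactor k D n w * p ^ (k - w) else 0)
    (fun w => by
      have := hg w
      positivity)
  -- Two families, `k` coordinates and `k` vertices of `e`: with c = 1/(4k²) this gives 2 · k · k ·
  -- c = 1/2.
  have hB1 : ∑ i, ∑ W : Finset (Fin k), (e.card : ℝ) ^ W.card * (n : ℝ) ^ (D - r i W) *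
      (if W.card = 1 then p ^ (k - 1) else 0) ≤ 1 / 2 := by
    calc _ ≤ ∑ _i : Fin 2, ∑ W : Finset (Fin k), (if W.card = 1 then 1 / (4 * (k : ℝ)) else 0) := by
          refine Finset.sum_le_sum fun i _ => Finset.sum_le_sum fun W _ => ?_
          split_ifs with hW
          · have h1 := pow_mul_pow_le (k := k) (D := D) hn hp0 hp (D - r i W) (k - 1)
            have hk1' : (0 : ℝ) < (k : ℝ) - 1 := by
              have : (3 : ℝ) ≤ k := by exact_mod_cast (by omega : 3 ≤ k)
              linarith
            have hexp : expo k D * ((k : ℝ) - 1) = D - 1 := by unfold expo; field_simp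
            have hr : (1 : ℝ) ≤ r i W := by exact_mod_cast (hY i).one W hW
            have h2 : (n : ℝ) ^ (((D - r i W : ℕ) : ℝ) - expo k D * ((k - 1 : ℕ) : ℝ)) ≤ 1 := by
              refine Real.rpow_le_one_of_one_le_of_nonpos (by exact_mod_cast hn) ?_
              rw [Nat.cast_sub ((hY i).le W), Nat.cast_sub (by omega), Nat.cast_one, hexp]
              linarith
            have h3 : (1 / (4 * (k : ℝ) ^ 2)) ^ (k - 1) ≤ 1 / (4 * (k : ℝ) ^ 2) :=
              pow_le_of_le_one hc0 hc1 (by omega)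
            rw [hW, hecard, pow_one, mul_assoc]
            calc (k : ℝ) * ((n : ℝ) ^ (D - r i W) * p ^ (k - 1))
                ≤ k * ((1 / (4 * (k : ℝ) ^ 2)) * 1) := by
                  exact mul_le_mul_of_nonneg_left
                    (h1.trans (mul_le_mul h3 h2 (by positivity) hc0)) hk0.le
              _ = 1 / (4 * (k : ℝ)) := by field_simp
          · simp
      _ = 1 / 2 := by
          have hcard : (Finset.univ.filter fun W : Finset (Fin k) => W.card = 1).card = k := by
            rw [← Finset.powerset_univ, ← Finset.powersetCard_eq_filter, Finset.card_powersetCard]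
            simp
          simp only [Finset.sum_ite, Finset.sum_const_zero, add_zero, Finset.sum_const, hcard,
            nsmul_eq_mul, Finset.card_univ, Fintype.card_fin]
          field_simp
          norm_num
  have hB2 : ∑ i, ∑ W : Finset (Fin k), (U.card : ℝ) ^ W.card * (n : ℝ) ^ (D - r i W) *
      (if 1 ≤ W.card ∧ W.card < k then gainFactor k D n W.card * p ^ (k - W.card) else 0) ≤
      2 ^ (k + 1) * ((k : ℝ) * N) ^ k := by
    calc _ ≤ ∑ _i : Fin 2, ∑ _W : Finset (Fin k), ((k : ℝ) * N) ^ k := by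
          refine Finset.sum_le_sum fun i _ => Finset.sum_le_sum fun W _ => ?_
          split_ifs with hW
          · have h1 := count_mul_gain_le hD hDk (hY i) hn hp0 hc0 hc1 hp hW.1 hW.2
            have hU1 : (1 : ℝ) ≤ U.card := by
              exact_mod_cast le_trans (by omega) (Finset.card_le_card heU)
            have hU2 : (U.card : ℝ) ≤ (k : ℝ) * N := by exact_mod_cast hU
            rw [mul_assoc]
            calc (U.card : ℝ) ^ W.card * _ ≤ (U.card : ℝ) ^ W.card * 1 := by gcongr
              _ ≤ (U.card : ℝ) ^ k := by
                  rw [mul_one]; exact pow_le_pow_right₀ hU1 hW.2.le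
              _ ≤ _ := by gcongr
          · rw [mul_zero]; positivity
      _ = _ := by
          simp only [Finset.sum_const, Finset.card_univ, Fintype.card_finset, Fintype.card_fin,
            nsmul_eq_mul]
          push_cast
          ring
  have := mul_le_mul_of_nonneg_left (hS2.trans hB2) hs
  have := hS1.trans hB1
  linarith

lemma sum_edges_pow_le (hD : 2 ≤ D) (hDk : D < k) (hY : ∀ i, Sparse D (r i) (Y i)) (hn : 1 ≤ n)
    (hp0 : 0 ≤ p) (hp : p ≤ 1 / (4 * (k : ℝ) ^ 2) * (n : ℝ) ^ (-expo k D)) :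
    ∑ e ∈ edges Y n, p ^ e.card ≤ 2 * (n : ℝ) ^ (1 - expo k D) := by
  have hk1 : (1 : ℝ) ≤ k := by exact_mod_cast (by omega : 1 ≤ k)
  have hc0 : (0 : ℝ) ≤ 1 / (4 * (k : ℝ) ^ 2) := by positivity
  have hc1 : 1 / (4 * (k : ℝ) ^ 2) ≤ 1 := by
    rw [div_le_one (by positivity)]
    nlinarith
  have hk1' : (0 : ℝ) < (k : ℝ) - 1 := by
    have : (3 : ℝ) ≤ k := by exact_mod_cast (by omega : 3 ≤ k)
    linarith
  have hexp : expo k D * ((k : ℝ) - 1) = D - 1 := by unfold expo; field_simp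
  have hn1 : (1 : ℝ) ≤ n := by exact_mod_cast hn
  have hcard : ((edges Y n).card : ℝ) ≤ 2 * (n : ℝ) ^ D := by
    have h1 : (edges Y n).card ≤ ∑ i, (solutions (Y i) n).card := by
      rw [← Finset.card_sigma]; exact Finset.card_image_le
    have h2 : ∀ i, (solutions (Y i) n).card ≤ n ^ D := fun i => by
      have := (hY i).count n hn ∅ ∅
      simp only [Finset.notMem_empty, false_imp_iff, implies_true, Finset.filter_true,
        Finset.card_empty, pow_zero, one_mul] at this
      exact this.trans (Nat.pow_le_pow_right hn (Nat.sub_le _ _))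
    have h3 : (edges Y n).card ≤ 2 * n ^ D := by
      refine h1.trans ((Finset.sum_le_sum fun i _ => h2 i).trans ?_)
      simp
    exact_mod_cast h3
  rw [Finset.sum_congr rfl fun e he => by rw [card_of_mem_edges he], Finset.sum_const,
    nsmul_eq_mul]
  have h1 := pow_mul_pow_le (k := k) (D := D) hn hp0 hp D k
  calc _ ≤ 2 * (n : ℝ) ^ D * p ^ k := by gcongr
    _ = 2 * ((n : ℝ) ^ D * p ^ k) := by ring
    _ ≤ 2 * (1 * (n : ℝ) ^ ((D : ℝ) - expo k D * k)) := by
        exact mul_le_mul_of_nonneg_left (h1.trans (mul_le_mul_of_nonneg_right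
          (pow_le_one₀ hc0 hc1) (by positivity))) zero_le_two
    _ = _ := by
        rw [one_mul]
        congr 2
        linear_combination -hexp

end Solutions

/-! ### The first moment argument below the threshold. -/

section Threshold

variable {k D : ℕ} {r : Fin 2 → Finset (Fin k) → ℕ} {Y : Fin 2 → Set (Fin k → ℤ)}

lemma Grow.subset_of_forall {α : Type*} [DecidableEq α] {E : Set (Finset α)} {k j a b l : ℕ}
    {U e : Finset α} {S : Set α} (h : Grow E k j a b l U e) (hE : ∀ e ∈ E, (e : Set α) ⊆ S) :
    (U : Set α) ⊆ S := by
  induction h with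
  | start he => exact hE _ he
  | run _ hf _ _ ih => rw [Finset.coe_union]; exact Set.union_subset ih (hE _ hf)
  | jump _ hf _ ih => rw [Finset.coe_union]; exact Set.union_subset ih (hE _ hf)
  | two _ hf _ ih => rw [Finset.coe_union]; exact Set.union_subset ih (hE _ hf)
  | gain _ hf _ _ ih => rw [Finset.coe_union]; exact Set.union_subset ih (hE _ hf)

/-- Every two-colouring of `S` has a monochromatic injective member of `Y i` in colour `i`, for
some `i`. -/
def Unavoidable (Y : Fin 2 → Set (Fin k → ℤ)) (S : Set ℤ) : Prop :=
  ∀ χ : ℤ → Fin 2, ∃ i, ∃ y ∈ Y i, Function.Injective y ∧ (∀ j, y j ∈ S) ∧ ∀ j, χ (y j) = i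

lemma Unavoidable.exists_critical (hk : 1 ≤ k) {n : ℕ} {S : Set ℤ} (hS : S ⊆ Set.Icc 1 (n : ℤ))
    (h : Unavoidable Y S) :
    ∃ E : Set (Finset ℤ), E ⊆ edges Y n ∧ (∀ e ∈ E, (e : Set ℤ) ⊆ S) ∧ Critical E k := by
  classical
  obtain ⟨E, hE, hc⟩ := RandomRado.exists_critical hk
    ((Finset.univ ×ˢ edges Y n).filter fun x : Fin 2 × Finset ℤ =>
      (∃ y ∈ solutions (Y x.1) n, Finset.univ.image y = x.2) ∧ (x.2 : Set ℤ) ⊆ S)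
    (fun x hx => card_of_mem_edges (Finset.mem_product.1 (Finset.mem_filter.1 hx).1).2)
    (fun χ => by
      obtain ⟨i, y, hy, hinj, hyS, hχ⟩ := h χ
      have hsol : y ∈ solutions (Y i) n := mem_solutions.2 ⟨fun j => hS (hyS j), hinj, hy⟩
      refine ⟨(i, Finset.univ.image y), ?_, ?_⟩
      · simp only [Finset.mem_filter, Finset.mem_product, Finset.mem_univ, true_and]
        refine ⟨mem_edges.2 ⟨i, y, hsol, rfl⟩, ⟨y, hsol, rfl⟩, ?_⟩
        intro x hx
        simp only [Finset.coe_image, Finset.coe_univ, Set.image_univ, Set.mem_range] at hx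
        obtain ⟨j, rfl⟩ := hx
        exact hyS j
      · intro v hv
        simp only [Finset.mem_image, Finset.mem_univ, true_and] at hv
        obtain ⟨j, rfl⟩ := hv
        exact hχ j)
  refine ⟨E, fun e he => ?_, fun e he => ?_, hc⟩
  · obtain ⟨i, hi⟩ := hE e he
    exact (Finset.mem_product.1 (Finset.mem_filter.1 hi).1).2
  · obtain ⟨i, hi⟩ := hE e he
    exact (Finset.mem_filter.1 hi).2.2

lemma one_sub_expo (hD : 2 ≤ D) (hDk : D < k) : 1 / ((k : ℝ) - 1) ≤ 1 - expo k D := by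
  have hDk' : (D : ℝ) + 1 ≤ k := by exact_mod_cast hDk
  have hD' : (2 : ℝ) ≤ D := by exact_mod_cast hD
  rw [expo, div_le_iff₀ (by linarith), sub_mul, div_mul_cancel₀ _ (by linarith)]
  linarith

lemma expo_pos (hD : 2 ≤ D) (hDk : D < k) : 0 < expo k D := by
  have hDk' : (D : ℝ) + 1 ≤ k := by exact_mod_cast hDk
  have hD' : (2 : ℝ) ≤ D := by exact_mod_cast hD
  exact div_pos (by linarith) (by linarith)

/-- First moment bound for unavoidability. -/
lemma measureReal_unavoidable_le (hD : 2 ≤ D) (hDk : D < k) (hY : ∀ i, Sparse D (r i) (Y i))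
    {n : ℕ} (hn : 1 ≤ n) (p : I)
    (hp : (p : ℝ) ≤ 1 / (4 * (k : ℝ) ^ 2) * (n : ℝ) ^ (-expo k D)) (T : ℕ) :
    (setBernoulli (Set.Icc (1 : ℤ) n) p).real {S | Unavoidable Y S} ≤
      2 * (n : ℝ) ^ (1 - expo k D) * (1 / 2) ^ T +
      (3 * T + 4) * (2 * (2 * (2 ^ (k + 1) * ((k : ℝ) * (3 * T + 4)) ^ k)) ^ 5 *
        (n : ℝ) ^ (-(1 / ((k : ℝ) - 1)))) := by
  have hk1 : (0 : ℝ) < (k : ℝ) - 1 := by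
    have : (3 : ℝ) ≤ k := by exact_mod_cast (by omega : 3 ≤ k)
    linarith
  have hk0 : (1 : ℝ) ≤ k := by linarith
  have hn1 : (1 : ℝ) ≤ n := by exact_mod_cast hn
  have hn0 : (0 : ℝ) < n := by linarith
  set g₂ := gainFactor k D n 2 with hg2
  set g₃ := gainFactor k D n 3 with hg3
  have hg2' : g₂ = (n : ℝ) ^ (1 - expo k D) := by simp [hg2, gainFactor]
  have hg3' : g₃ = (n : ℝ) ^ (1 / ((k : ℝ) - 1)) := by simp [hg3, gainFactor]
  have hg3pos : 1 ≤ g₃ := by rw [hg3']; exact Real.one_le_rpow hn1 (by positivity)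
  have hg23 : g₃ ≤ g₂ := by
    rw [hg3', hg2']; exact Real.rpow_le_rpow_of_exponent_le hn1 (one_sub_expo hD hDk)
  have hg20 : 0 < g₂ := by linarith
  have hg30 : 0 < g₃ := by linarith
  set K : ℝ := 2 ^ (k + 1) * ((k : ℝ) * (3 * T + 4)) ^ k with hK
  have hK1 : 1 ≤ K := by
    have hT : (0 : ℝ) ≤ T := Nat.cast_nonneg _
    have h1 : (1 : ℝ) ≤ 2 ^ (k + 1) := one_le_pow₀ (by norm_num)
    have h2 : (1 : ℝ) ≤ ((k : ℝ) * (3 * T + 4)) ^ k := one_le_pow₀ (by nlinarith)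
    nlinarith
  have hM := sum_edges_pow_le hD hDk hY hn p.2.1 hp
  have hu : ∀ e ∈ edges Y n, e.card = k := fun e he => card_of_mem_edges he
  -- Chosen so that exceptional steps contribute `K * s = 1/2`, making the total per step at most 1.
  let s : ℝ := 1 / (2 * K)
  have hs0 : 0 < s := by positivity
  have hs1 : s ≤ 1 := by
    rw [div_le_one (by positivity)]; linarith
  -- With `s = 0` only pure paths keep positive weight, and each step halves the sum.
  have hsum0 := sum_lists_le (k := k) (E := edges Y n) (p := p) (s := 0) (g₂ := g₂) (g₃ := g₃)
    (M := 2 * (n : ℝ) ^ (1 - expo k D)) (κ := 1 / 2) p.2.1 le_rfl hg20.le hg30.le (by norm_num) hu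
    hM T (fun U e hU heU he => by
      have := sum_step_le hD hDk hY hn p.2.1 hp le_rfl hU heU he
      simpa using this) le_rfl
  have hsum : ∀ l ≤ 3 * T + 4, _ := fun l (hl : l ≤ 3 * T + 4) =>
    sum_lists_le (k := k) (E := edges Y n) (p := p) (s := s) (g₂ := g₂) (g₃ := g₃)
    (M := 2 * (n : ℝ) ^ (1 - expo k D)) (κ := 1) p.2.1 hs0.le hg20.le hg30.le (by norm_num) hu
    hM (3 * T + 4) (fun U e hU heU he => by
      have := sum_step_le hD hDk hY hn p.2.1 hp hs0.le hU heU he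
      push_cast at this
      rw [← hK] at this
      have h2 : K * s = 1 / 2 := by simp only [s]; field_simp
      linarith) hl
  have hP0 := measureReal_exists_list_le (lam := 1) (Set.Icc (1 : ℤ) n) p le_rfl hg20.le hg30.le
    one_pos hsum0
  have hlam : 0 < s ^ 5 * g₂ * g₃ := by positivity
  have hP := fun l hl => measureReal_exists_list_le (Set.Icc (1 : ℤ) n) p hs0.le hg20.le hg30.le
    hlam (hsum l hl)
  have hsub : {S | S ∈ {S | Unavoidable Y S} ∧ S ⊆ Set.Icc (1 : ℤ) n} ⊆
      {S | ∃ L ∈ lists (edges Y n) T, 1 ≤ listWeight k 0 g₂ g₃ L ∧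
        ((listUnion L : Finset ℤ) : Set ℤ) ⊆ S} ∪
      ⋃ l ∈ Finset.range (3 * T + 4), {S | ∃ L ∈ lists (edges Y n) l,
        s ^ 5 * g₂ * g₃ ≤ listWeight k s g₂ g₃ L ∧
        ((listUnion L : Finset ℤ) : Set ℤ) ⊆ S} := by
    rintro S ⟨hS, hSn⟩
    obtain ⟨E, hE, hES, hc⟩ := Unavoidable.exists_critical (by omega) hSn hS
    by_cases hT : ∀ U e, ¬ Grow E k 0 0 0 T U e
    · right
      obtain ⟨j, hj, l, hl, U, e, hG⟩ := hc.exists_grow (by omega) hT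
      obtain ⟨L, hL, hU, hw⟩ := (hG.mono hE).exists_list hs0.le hs1 hg23 hg3pos
      simp only [Set.mem_iUnion, Finset.mem_range]
      refine ⟨l, by omega, e :: L, hL, le_trans ?_ hw, hU ▸ hG.subset_of_forall hES⟩
      rw [pow_one, pow_one]
      have := pow_le_pow_of_le_one hs0.le hs1 hj
      gcongr
    · left
      push Not at hT
      obtain ⟨U, e, hG⟩ := hT
      obtain ⟨L, hL, hU, hw⟩ := (hG.mono hE).exists_list le_rfl zero_le_one hg23 hg3pos
      exact ⟨e :: L, hL, by simpa using hw, hU ▸ hG.subset_of_forall hES⟩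
  -- The random set is almost surely contained in `{1, …, n}`.
  have hae : (setBernoulli (Set.Icc (1 : ℤ) n) p).real {S | Unavoidable Y S} =
      (setBernoulli (Set.Icc (1 : ℤ) n) p).real
        {S | S ∈ {S | Unavoidable Y S} ∧ S ⊆ Set.Icc (1 : ℤ) n} := by
    rw [measureReal_def, setBernoulli_apply_eq_apply_subsets]; rfl
  rw [hae]
  refine (measureReal_mono hsub (measure_ne_top _ _)).trans ((measureReal_union_le _ _).trans ?_)
  refine add_le_add (hP0.trans (by rw [div_one])) ((measureReal_biUnion_finset_le _ _).trans ?_)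
  refine (Finset.sum_le_sum fun l hl => hP l (Finset.mem_range.1 hl).le).trans (le_of_eq ?_)
  have hneg : (n : ℝ) ^ (-(1 / ((k : ℝ) - 1))) = g₃⁻¹ := by rw [hg3', Real.rpow_neg hn0.le]
  rw [hneg, ← hg2']
  simp only [one_pow, mul_one, Finset.sum_const, Finset.card_range, nsmul_eq_mul, s]
  push_cast
  field_simp

lemma tendsto_log_pow_mul_rpow {C : ℝ} {q : ℕ} {ε : ℝ} (hε : 0 < ε) (hq : q ≠ 0) :
    Tendsto (fun n : ℕ => C * (3 * (Nat.clog 2 n : ℝ) + 4) ^ q * (n : ℝ) ^ (-ε)) atTop (𝓝 0) := by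
  have hq' : (0 : ℝ) < q := by positivity
  have hδ : 0 < ε / q := by positivity
  have h1 : Tendsto (fun x : ℝ => (6 * Real.log x + 7) * x ^ (-(ε / q))) atTop (𝓝 0) := by
    have ha : Tendsto (fun x : ℝ => Real.log x / x ^ (ε / q)) atTop (𝓝 0) :=
      (isLittleO_log_rpow_atTop hδ).tendsto_div_nhds_zero
    have hb := tendsto_rpow_neg_atTop hδ
    have := (ha.const_mul 6).add (hb.const_mul 7)
    simp only [mul_zero, add_zero] at this
    refine this.congr' ?_
    filter_upwards [eventually_gt_atTop 0] with x hx
    rw [Real.rpow_neg hx.le]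
    field_simp
  have h2 : Tendsto (fun n : ℕ => (3 * (Nat.clog 2 n : ℝ) + 4) * (n : ℝ) ^ (-(ε / q)))
      atTop (𝓝 0) := by
    refine squeeze_zero' (Eventually.of_forall fun n => by positivity) ?_
      (h1.comp tendsto_natCast_atTop_atTop)
    filter_upwards [eventually_ge_atTop 1] with n hn
    have hn1 : (1 : ℝ) ≤ n := by exact_mod_cast hn
    have hlog : 0 ≤ Real.log n := Real.log_nonneg hn1
    have hclog : (Nat.clog 2 n : ℝ) ≤ 2 * Real.log n + 1 := by
      rw [← Real.natCeil_logb_natCast]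
      have hb : (0 : ℝ) ≤ Real.logb 2 n := Real.logb_nonneg (by norm_num) hn1
      refine (Nat.ceil_lt_add_one (by exact_mod_cast hb)).le.trans ?_
      have hl2 := Real.log_two_gt_d9
      have : Real.logb 2 n ≤ 2 * Real.log n := by
        rw [Real.logb, div_le_iff₀ (by linarith)]
        nlinarith
      push_cast
      linarith
    exact mul_le_mul_of_nonneg_right (by linarith) (by positivity)
  have h3 := (h2.pow q).const_mul C
  rw [zero_pow hq, mul_zero] at h3
  refine h3.congr' ?_
  filter_upwards [eventually_ge_atTop 1] with n hn
  have hn0 : (0 : ℝ) ≤ n := by positivity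
  rw [mul_pow, ← Real.rpow_natCast ((n : ℝ) ^ (-(ε / q))), ← Real.rpow_mul hn0]
  have : -(ε / q) * (q : ℝ) = -ε := by field_simp
  rw [this]
  ring

/-- Below the threshold, sparse families are almost surely avoidable by a two-colouring. -/
theorem tendsto_unavoidable (hD : 2 ≤ D) (hDk : D < k) (hY : ∀ i, Sparse D (r i) (Y i))
    (p : ℕ → I)
    (hp : ∀ᶠ n : ℕ in atTop, (p n : ℝ) ≤ 1 / (4 * (k : ℝ) ^ 2) * (n : ℝ) ^ (-expo k D)) :
    Tendsto (fun n : ℕ => (setBernoulli (Set.Icc (1 : ℤ) n) (p n)).real {S | Unavoidable Y S})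
      atTop (𝓝 0) := by
  have hk1 : (0 : ℝ) < (k : ℝ) - 1 := by
    have : (3 : ℝ) ≤ k := by exact_mod_cast (by omega : 3 ≤ k)
    linarith
  have hlim1 : Tendsto (fun n : ℕ => 2 * (n : ℝ) ^ (-expo k D)) atTop (𝓝 0) := by
    have := ((tendsto_rpow_neg_atTop (expo_pos hD hDk)).comp
      tendsto_natCast_atTop_atTop).const_mul (2 : ℝ)
    simpa using this
  have hlim2 := tendsto_log_pow_mul_rpow
    -- The exponent `5 * k + 1` collects `5 * k` logarithms from the five exceptional steps and one
    -- from the sum over lengths.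
    (C := 2 * (2 * (2 ^ (k + 1) * (k : ℝ) ^ k)) ^ 5) (q := 5 * k + 1)
    (ε := 1 / ((k : ℝ) - 1)) (by positivity) (by omega)
  have hlim := hlim1.add hlim2
  rw [add_zero] at hlim
  refine squeeze_zero' (Eventually.of_forall fun n => measureReal_nonneg) ?_ hlim
  filter_upwards [hp, eventually_ge_atTop 1] with n hpn hn
  refine (measureReal_unavoidable_le hD hDk hY hn (p n) hpn (Nat.clog 2 n)).trans ?_
  have hn0 : (0 : ℝ) < n := by exact_mod_cast hn
  refine add_le_add ?_ (le_of_eq ?_)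
  · have h1 : (n : ℝ) ≤ 2 ^ Nat.clog 2 n := by exact_mod_cast Nat.le_pow_clog one_lt_two n
    have h2 : ((1 : ℝ) / 2) ^ Nat.clog 2 n ≤ (n : ℝ)⁻¹ := by
      rw [one_div, inv_pow]
      exact inv_anti₀ hn0 h1
    calc _ ≤ 2 * (n : ℝ) ^ (1 - expo k D) * (n : ℝ)⁻¹ := by gcongr
      _ = _ := by
        rw [← Real.rpow_neg_one, mul_assoc, ← Real.rpow_add hn0]
        congr 2
        ring
  · rw [mul_pow (k : ℝ)]
    generalize 3 * (Nat.clog 2 n : ℝ) + 4 = x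
    ring

end Threshold

/-! ### Ranks of coordinate projections -/

section Projection

variable {k : ℕ}

/-- The restriction of vectors to the coordinates in `W`. -/
def restrict (W : Finset (Fin k)) : (Fin k → ℚ) →ₗ[ℚ] ({j // j ∈ W} → ℚ) :=
  LinearMap.funLeft ℚ ℚ Subtype.val

lemma mem_ker_restrict {W : Finset (Fin k)} {x : Fin k → ℚ} :
    x ∈ LinearMap.ker (restrict W) ↔ ∀ j ∈ W, x j = 0 := by
  simp [restrict, funext_iff, LinearMap.funLeft_apply]

/-- The dimension of the projection of `V` to the coordinates in `W`. -/
def projRank (V : Submodule ℚ (Fin k → ℚ)) (W : Finset (Fin k)) : ℕ :=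
  finrank ℚ (V.map (restrict W))

lemma projRank_add_finrank (V : Submodule ℚ (Fin k → ℚ)) (W : Finset (Fin k)) :
    projRank V W + finrank ℚ (V ⊓ LinearMap.ker (restrict W) : Submodule ℚ (Fin k → ℚ)) =
      finrank ℚ V := by
  have h := LinearMap.finrank_range_add_finrank_ker ((restrict W).domRestrict V)
  rw [LinearMap.range_domRestrict, LinearMap.ker_domRestrict] at h
  rw [projRank, ← h]
  congr 1
  rw [← Submodule.map_comap_subtype]
  exact Submodule.finrank_map_subtype_eq _ _

lemma projRank_le (V : Submodule ℚ (Fin k → ℚ)) (W : Finset (Fin k)) :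
    projRank V W ≤ finrank ℚ V := by
  have := projRank_add_finrank V W; omega

lemma projRank_univ (V : Submodule ℚ (Fin k → ℚ)) :
    projRank V Finset.univ = finrank ℚ V := by
  rw [← projRank_add_finrank V Finset.univ]
  have : V ⊓ LinearMap.ker (restrict (Finset.univ : Finset (Fin k))) = ⊥ := by
    rw [eq_bot_iff]
    rintro x ⟨-, hx⟩
    rw [SetLike.mem_coe, mem_ker_restrict] at hx
    exact funext fun j => hx j (Finset.mem_univ j)
  rw [this]; simp

/-- A subspace of dimension `d` is determined by at most `d` coordinates. -/
lemma exists_determining_coordinates (V : Submodule ℚ (Fin k → ℚ)) :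
    ∃ J : Finset (Fin k), J.card ≤ finrank ℚ V ∧ ∀ x ∈ V, (∀ j ∈ J, x j = 0) → x = 0 := by
  classical
  induction hd : finrank ℚ V using Nat.strong_induction_on generalizing V with
  | _ d ih =>
    by_cases hV : V = ⊥
    · exact ⟨∅, by simp, fun x hx _ => by simpa [hV] using hx⟩
    obtain ⟨x, hx, hx0⟩ := Submodule.exists_mem_ne_zero_of_ne_bot hV
    obtain ⟨j, hj⟩ := Function.ne_iff.1 hx0
    have hlt : V ⊓ LinearMap.ker (restrict {j}) < V := by
      refine lt_of_le_of_ne inf_le_left fun h => hj ?_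
      rw [← h] at hx
      exact mem_ker_restrict.1 hx.2 j (by simp)
    obtain ⟨J, hJ, hdet⟩ := ih _ (hd ▸ Submodule.finrank_lt_finrank_of_lt hlt) _ rfl
    refine ⟨insert j J, ?_, fun y hy hyJ => hdet y ⟨hy, ?_⟩ fun i hi => hyJ i (by simp [hi])⟩
    · have h1 := Submodule.finrank_lt_finrank_of_lt hlt
      have h2 := Finset.card_insert_le j J
      omega
    · rw [SetLike.mem_coe, mem_ker_restrict]
      intro i hi
      rw [Finset.mem_singleton] at hi
      exact hyJ i (by simp [hi])

/-- Once the coordinates in `W` are fixed, differences lie in the subspace of `V` vanishing on `W`,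
of dimension `finrank ℚ V - projRank V W`; that many further coordinates determine the solution. -/
lemma card_solutions_le {V : Submodule ℚ (Fin k → ℚ)} {Y : Set (Fin k → ℤ)}
    (hY : ∀ y ∈ Y, ∀ y' ∈ Y, (fun j => (y j : ℚ) - y' j) ∈ V) {n : ℕ} (hn : 1 ≤ n)
    (X : Finset ℤ) (W : Finset (Fin k)) :
    ((solutions Y n).filter fun y => ∀ j ∈ W, y j ∈ X).card ≤
      X.card ^ W.card * n ^ (finrank ℚ V - projRank V W) := by
  classical
  obtain ⟨J, hJ, hdet⟩ := exists_determining_coordinates (V ⊓ LinearMap.ker (restrict W))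
  have hfr := projRank_add_finrank V W
  have hcard : ((solutions Y n).filter fun y => ∀ j ∈ W, y j ∈ X).card ≤
      ((Fintype.piFinset fun _ : {j // j ∈ W} => X) ×ˢ
        (Fintype.piFinset fun _ : {j // j ∈ J} => Finset.Icc (1 : ℤ) n)).card := by
    refine Finset.card_le_card_of_injOn
      (fun y => ((fun j => y j.1), (fun j => y j.1))) ?_ ?_
    · intro y hy
      have hy := Finset.mem_filter.1 (Finset.mem_coe.1 hy)
      have hs := mem_solutions.1 hy.1
      simp only [Finset.coe_product, Set.mem_prod, Finset.mem_coe, Fintype.mem_piFinset,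
        Finset.mem_Icc]
      exact ⟨fun j => hy.2 j.1 j.2, fun j => hs.1 j.1⟩
    · intro y hy y' hy' heq
      have hy := mem_solutions.1 (Finset.mem_filter.1 (Finset.mem_coe.1 hy)).1
      have hy' := mem_solutions.1 (Finset.mem_filter.1 (Finset.mem_coe.1 hy')).1
      rw [Prod.mk.injEq] at heq
      have h0 := hdet (fun j => (y j : ℚ) - y' j) ⟨hY y hy.2.2 y' hy'.2.2, ?_⟩ ?_
      · funext j
        have := congrFun h0 j
        simp only [Pi.zero_apply, sub_eq_zero] at this
        exact_mod_cast this
      · rw [SetLike.mem_coe, mem_ker_restrict]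
        intro j hj
        have := congrFun heq.1 ⟨j, hj⟩
        simp only at this
        simp [this]
      · intro j hj
        have := congrFun heq.2 ⟨j, hj⟩
        simp only at this
        simp [this]
  refine hcard.trans ?_
  rw [Finset.card_product, Fintype.card_piFinset, Fintype.card_piFinset]
  simp only [Finset.prod_const, Finset.card_univ, Fintype.card_coe, Int.card_Icc]
  refine Nat.mul_le_mul_left _ ?_
  rw [show ((n : ℤ) + 1 - 1).toNat = n by simp]
  exact Nat.pow_le_pow_right hn (by omega)

lemma one_le_projRank {V : Submodule ℚ (Fin k → ℚ)} {W : Finset (Fin k)} {x : Fin k → ℚ}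
    (hx : x ∈ V) {j : Fin k} (hj : j ∈ W) (hxj : x j ≠ 0) : 1 ≤ projRank V W := by
  rw [projRank, Nat.one_le_iff_ne_zero, Ne, Submodule.finrank_eq_zero]
  intro h
  have h1 : restrict W x ∈ V.map (restrict W) := Submodule.mem_map_of_mem hx
  rw [h, Submodule.mem_bot] at h1
  exact hxj (mem_ker_restrict.1 h1 j hj)

lemma mul_eq_mul_of_projRank_le_one {V : Submodule ℚ (Fin k → ℚ)} {W : Finset (Fin k)}
    (hV : projRank V W ≤ 1) {x y : Fin k → ℚ} (hx : x ∈ V) (hy : y ∈ V) {i j : Fin k}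
    (hi : i ∈ W) (hj : j ∈ W) : y i * x j = y j * x i := by
  obtain ⟨v, hv⟩ := finrank_le_one_iff.1 hV
  obtain ⟨a, ha⟩ := hv ⟨restrict W x, Submodule.mem_map_of_mem hx⟩
  obtain ⟨b, hb⟩ := hv ⟨restrict W y, Submodule.mem_map_of_mem hy⟩
  have ha' : ∀ (j) (hj : j ∈ W), a * v.1 ⟨j, hj⟩ = x j := fun j hj =>
    congrFun (congrArg Subtype.val ha) ⟨j, hj⟩
  have hb' : ∀ (j) (hj : j ∈ W), b * v.1 ⟨j, hj⟩ = y j := fun j hj =>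
    congrFun (congrArg Subtype.val hb) ⟨j, hj⟩
  rw [← ha' i hi, ← ha' j hj, ← hb' i hi, ← hb' j hj]
  ring

/-- The projection rank after restricting to a subset of the coordinates. -/
lemma projRank_map_funLeft {m : ℕ} (V : Submodule ℚ (Fin k → ℚ)) (e : Fin m ↪ Fin k)
    (U : Finset (Fin m)) :
    projRank (V.map (LinearMap.funLeft ℚ ℚ e)) U = projRank V (U.map e) := by
  let φ : {j // j ∈ U} ≃ {j // j ∈ U.map e} :=
    Equiv.ofBijective (fun j => ⟨e j.1, Finset.mem_map_of_mem e j.2⟩)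
      ⟨fun a b h => Subtype.ext (e.injective (congrArg Subtype.val h)), fun b => by
        obtain ⟨a, ha, hab⟩ := Finset.mem_map.1 b.2
        exact ⟨⟨a, ha⟩, Subtype.ext hab⟩⟩
  have h : (V.map (LinearMap.funLeft ℚ ℚ e)).map (restrict U) =
      (V.map (restrict (U.map e))).map
        (LinearEquiv.funCongrLeft ℚ ℚ φ : ({j // j ∈ U.map e} → ℚ) →ₗ[ℚ] ({j // j ∈ U} → ℚ)) := by
    rw [← Submodule.map_comp, ← Submodule.map_comp]
    rfl
  rw [projRank, h, projRank]
  exact LinearEquiv.finrank_map_eq _ _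

end Projection

/-! ### Kernels of integer matrices -/

section Kernel

variable {ℓ k : ℕ}

/-- The rational solutions of `A x = 0`. -/
def ratKer (A : Matrix (Fin ℓ) (Fin k) ℤ) : Submodule ℚ (Fin k → ℚ) :=
  LinearMap.ker (A.map (Int.cast : ℤ → ℚ)).mulVecLin

lemma mem_ratKer {A : Matrix (Fin ℓ) (Fin k) ℤ} {x : Fin k → ℚ} :
    x ∈ ratKer A ↔ A.map (Int.cast : ℤ → ℚ) *ᵥ x = 0 := by
  simp [ratKer]

lemma map_cast_mulVec (A : Matrix (Fin ℓ) (Fin k) ℤ) (x : Fin k → ℤ) :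
    A.map (Int.cast : ℤ → ℚ) *ᵥ (fun j => (x j : ℚ)) = fun i => ((A *ᵥ x) i : ℚ) := by
  ext i
  simp [Matrix.mulVec, dotProduct]

lemma cast_mem_ratKer {A : Matrix (Fin ℓ) (Fin k) ℤ} {x : Fin k → ℤ} (hx : A *ᵥ x = 0) :
    (fun j => (x j : ℚ)) ∈ ratKer A := by
  rw [mem_ratKer, map_cast_mulVec, hx]
  ext; simp

/-- Kernel vectors vanishing on `W` are the extensions by zero of the kernel of the columns outside
`W`; rank-nullity is applied to that submatrix. -/
lemma finrank_ratKer_inf (A : Matrix (Fin ℓ) (Fin k) ℤ) (W : Finset (Fin k)) :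
    colRank A Wᶜ + finrank ℚ (ratKer A ⊓ LinearMap.ker (restrict W) : Submodule ℚ (Fin k → ℚ)) =
      k - W.card := by
  set M := (A.map (Int.cast : ℤ → ℚ)).submatrix id (Subtype.val : {j // j ∈ Wᶜ} → Fin k) with hM
  have h := LinearMap.finrank_range_add_finrank_ker M.mulVecLin
  have hcard : finrank ℚ ({j // j ∈ Wᶜ} → ℚ) = k - W.card := by
    rw [Module.finrank_fintype_fun_eq_card, Fintype.card_coe, Finset.card_compl, Fintype.card_fin]
  have hext : ∀ x : {j // j ∈ Wᶜ} → ℚ, ∀ i,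
      (A.map (Int.cast : ℤ → ℚ) *ᵥ Function.ExtendByZero.linearMap ℚ Subtype.val x) i =
        (M *ᵥ x) i := by
    intro x i
    have h1 : ∀ j ∉ Wᶜ, Function.ExtendByZero.linearMap ℚ (Subtype.val : {j // j ∈ Wᶜ} → Fin k) x j
        = 0 := fun j hj => by
      simp only [Function.ExtendByZero.linearMap_apply]
      exact Function.extend_apply' _ _ _ (by rintro ⟨a, rfl⟩; exact hj a.2)
    simp only [Matrix.mulVec, dotProduct]
    rw [← Finset.sum_subset (Finset.subset_univ Wᶜ) (fun j _ hj => by rw [h1 j hj, mul_zero]),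
      ← Finset.sum_coe_sort Wᶜ]
    refine Finset.sum_congr rfl fun j _ => ?_
    rw [Function.ExtendByZero.linearMap_apply, Subtype.val_injective.extend_apply]
    rfl
  have hmap : (LinearMap.ker M.mulVecLin).map
      (Function.ExtendByZero.linearMap ℚ (Subtype.val : {j // j ∈ Wᶜ} → Fin k)) =
      ratKer A ⊓ LinearMap.ker (restrict W) := by
    ext x
    constructor
    · rintro ⟨y, hy, rfl⟩
      refine ⟨?_, ?_⟩
      · rw [SetLike.mem_coe, mem_ratKer]
        ext i
        rw [hext y i]
        exact congrFun (show M *ᵥ y = 0 from hy) i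
      · rw [SetLike.mem_coe, mem_ker_restrict]
        intro j hj
        simp only [Function.ExtendByZero.linearMap_apply]
        refine Function.extend_apply' _ _ _ ?_
        rintro ⟨a, rfl⟩
        exact Finset.mem_compl.1 a.2 hj
    · rintro ⟨hx, hxW⟩
      rw [SetLike.mem_coe, mem_ker_restrict] at hxW
      rw [SetLike.mem_coe, mem_ratKer] at hx
      have hxe : Function.ExtendByZero.linearMap ℚ (Subtype.val : {j // j ∈ Wᶜ} → Fin k)
          (fun j => x j.1) = x := by
        ext j
        simp only [Function.ExtendByZero.linearMap_apply]
        by_cases hj : j ∈ W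
        · rw [hxW j hj]
          refine Function.extend_apply' _ _ _ ?_
          rintro ⟨a, rfl⟩
          exact Finset.mem_compl.1 a.2 hj
        · exact Subtype.val_injective.extend_apply _ _ (⟨j, Finset.mem_compl.2 hj⟩ : {j // j ∈ Wᶜ})
      refine ⟨fun j => x j.1, ?_, hxe⟩
      rw [SetLike.mem_coe, LinearMap.mem_ker, Matrix.mulVecLin_apply]
      ext i
      rw [← hext, hxe, hx]
  have hinj : Function.Injective
      (Function.ExtendByZero.linearMap ℚ (Subtype.val : {j // j ∈ Wᶜ} → Fin k)) := by
    intro a b hab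
    ext j
    have := congrFun hab j.1
    simpa only [Function.ExtendByZero.linearMap_apply, Subtype.val_injective.extend_apply] using this
  rw [← hmap, ← (Submodule.equivMapOfInjective _ hinj _).finrank_eq, ← hcard, ← h]
  rfl

lemma finrank_ratKer (A : Matrix (Fin ℓ) (Fin k) ℤ) :
    colRank A Finset.univ + finrank ℚ (ratKer A) = k := by
  have h := finrank_ratKer_inf A ∅
  have h1 : LinearMap.ker (restrict (∅ : Finset (Fin k))) = ⊤ := by
    ext x; rw [mem_ker_restrict]; simp
  rwa [h1, inf_top_eq, Finset.compl_empty, Finset.card_empty, Nat.sub_zero] at h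

lemma projRank_ratKer (A : Matrix (Fin ℓ) (Fin k) ℤ) (W : Finset (Fin k)) :
    projRank (ratKer A) W + colRank A Finset.univ = W.card + colRank A Wᶜ := by
  have h1 := finrank_ratKer A
  have h2 := finrank_ratKer_inf A W
  have h3 := projRank_add_finrank (ratKer A) W
  have h4 := Finset.card_le_univ W
  rw [Fintype.card_fin] at h4
  omega

/-- Two coordinates in a fixed ratio other than `1` can be separated by a finite colouring. -/
lemma exists_colouring {a b : ℤ} (ha : 0 < a) (hb : 0 < b) (hab : a ≠ b) :
    ∃ (r : ℕ) (χ : ℤ → Fin r), ∀ y z : ℤ, 0 < y → 0 < z → y * b = z * a → χ y ≠ χ z := by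
  obtain ⟨q, hq, hne⟩ : ∃ q : ℕ, q.Prime ∧ padicValInt q a ≠ padicValInt q b := by
    by_contra! h
    apply hab
    have : a.natAbs = b.natAbs := by
      refine Nat.eq_of_factorization_eq (by omega) (by omega) fun q => ?_
      by_cases hq : q.Prime
      · rw [Nat.factorization_def _ hq, Nat.factorization_def _ hq]
        exact h q hq
      · rw [Nat.factorization_eq_zero_of_not_prime _ hq, Nat.factorization_eq_zero_of_not_prime _ hq]
    omega
  have := Fact.mk hq
  -- A modulus exceeding both valuations, so that they stay distinct modulo `m`.
  set m := padicValInt q a + padicValInt q b + 1 with hm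
  refine ⟨m, fun z => ⟨padicValInt q z % m, Nat.mod_lt _ (by omega)⟩, fun y z hy hz h heq => ?_⟩
  have h1 := congrArg (padicValInt q) h
  rw [padicValInt.mul hy.ne' hb.ne', padicValInt.mul hz.ne' ha.ne'] at h1
  have h2 : padicValInt q y % m = padicValInt q z % m := congrArg Fin.val heq
  have h3 : padicValInt q y ≡ padicValInt q z [MOD m] := h2
  have h4 : padicValInt q a ≡ padicValInt q b [MOD m] := by
    have : padicValInt q z + padicValInt q a ≡ padicValInt q z + padicValInt q b [MOD m] := by
      rw [← h1]
      exact h3.add_right _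
    exact Nat.ModEq.add_left_cancel' _ this
  exact hne (Nat.ModEq.eq_of_lt_of_lt h4 (by omega) (by omega))

/-- If the projection had dimension at most 1, any two coordinates in `W` would have the same ratio
in every positive solution. A distinct solution shows that the ratio is not 1, and
`exists_colouring` then excludes monochromatic solutions. -/
lemma two_le_projRank {A : Matrix (Fin ℓ) (Fin k) ℤ} (hA : Irredundant A 0)
    (hPR : PartitionRegular A) {W : Finset (Fin k)} (hW : 2 ≤ W.card) :
    2 ≤ projRank (ratKer A) W := by
  by_contra hlt
  obtain ⟨x, hinj, hpos, hx⟩ := hA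
  obtain ⟨i, hi, j, hj, hij⟩ := Finset.one_lt_card.1 hW
  obtain ⟨r, χ, hχ⟩ := exists_colouring (hpos i) (hpos j) (fun h => hij (hinj h))
  obtain ⟨c, y, hy, hAy⟩ := hPR r χ
  have h := mul_eq_mul_of_projRank_le_one (by omega) (cast_mem_ratKer hx) (cast_mem_ratKer hAy) hi hj
  refine hχ (y i) (y j) (hy i).1 (hy j).1 (by exact_mod_cast h) ?_
  rw [(hy i).2, (hy j).2]

lemma one_le_projRank_ratKer {A : Matrix (Fin ℓ) (Fin k) ℤ} (hA : Irredundant A 0)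
    {W : Finset (Fin k)} (hW : 1 ≤ W.card) : 1 ≤ projRank (ratKer A) W := by
  obtain ⟨x, hinj, hpos, hx⟩ := hA
  obtain ⟨j, hj⟩ := Finset.card_pos.1 hW
  exact one_le_projRank (cast_mem_ratKer hx) hj (by
    have : 0 < x j := hpos j
    exact_mod_cast this.ne')

end Kernel

/-! ### The threshold parameters -/

section Parameters

variable {ℓ k : ℕ}

/-- The term of `W` in the definition of `mParam`, in terms of the projection rank. -/
def mRatio (A : Matrix (Fin ℓ) (Fin k) ℤ) (W : Finset (Fin k)) : ℝ :=
  ((W.card : ℝ) - 1) / ((projRank (ratKer A) W : ℝ) - 1)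

lemma colRank_sub (A : Matrix (Fin ℓ) (Fin k) ℤ) (W : Finset (Fin k)) :
    (W.card : ℝ) - 1 + (colRank A Wᶜ : ℝ) - (colRank A Finset.univ : ℝ) =
      (projRank (ratKer A) W : ℝ) - 1 := by
  have h : ((projRank (ratKer A) W + colRank A Finset.univ : ℕ) : ℝ) =
      ((W.card + colRank A Wᶜ : ℕ) : ℝ) := by rw [projRank_ratKer]
  push_cast at h
  linarith

lemma mParam_eq_iSup (A : Matrix (Fin ℓ) (Fin k) ℤ) :
    mParam A = ⨆ W : {W : Finset (Fin k) // 2 ≤ W.card}, mRatio A W.1 := by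
  simp only [mParam, mRatio, colRank_sub]

lemma mRatio_le_mParam (A : Matrix (Fin ℓ) (Fin k) ℤ) {W : Finset (Fin k)} (hW : 2 ≤ W.card) :
    mRatio A W ≤ mParam A := by
  rw [mParam_eq_iSup]
  exact le_ciSup (f := fun W : {W : Finset (Fin k) // 2 ≤ W.card} => mRatio A W.1)
    (Set.finite_range _).bddAbove ⟨W, hW⟩

lemma exists_mRatio_eq_mParam (A : Matrix (Fin ℓ) (Fin k) ℤ) (hk : 2 ≤ k) :
    ∃ W : Finset (Fin k), 2 ≤ W.card ∧ mRatio A W = mParam A := by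
  have : Nonempty {W : Finset (Fin k) // 2 ≤ W.card} := ⟨⟨Finset.univ, by simpa using hk⟩⟩
  obtain ⟨W, hW⟩ := exists_eq_ciSup_of_finite
    (f := fun W : {W : Finset (Fin k) // 2 ≤ W.card} => mRatio A W.1)
  exact ⟨W.1, W.2, by rw [mParam_eq_iSup]; exact hW⟩

lemma finrank_ratKer_of_fullRank {A : Matrix (Fin ℓ) (Fin k) ℤ} (hA : FullRank A) :
    ℓ + finrank ℚ (ratKer A) = k := by
  have h := finrank_ratKer A
  unfold FullRank at hA
  rwa [hA] at h

lemma StrictlyBalanced.mRatio_lt {C : Matrix (Fin ℓ) (Fin k) ℤ} (hC : StrictlyBalanced C)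
    (hf : FullRank C) {W : Finset (Fin k)} (hW : 2 ≤ W.card) (hWk : W.card < k) :
    mRatio C W < ((k : ℝ) - 1) / ((k : ℝ) - 1 - (ℓ : ℝ)) := by
  have h := hC W hW hWk
  have h1 := colRank_sub C W
  rw [FullRank] at hf
  rw [hf] at h1
  rwa [h1] at h

lemma mRatio_univ {C : Matrix (Fin ℓ) (Fin k) ℤ} (hf : FullRank C) :
    mRatio C Finset.univ = ((k : ℝ) - 1) / ((k : ℝ) - 1 - (ℓ : ℝ)) := by
  have h := finrank_ratKer_of_fullRank hf
  have h' : (ℓ : ℝ) + (finrank ℚ (ratKer C) : ℝ) = k := by exact_mod_cast h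
  rw [mRatio, projRank_univ, Finset.card_univ, Fintype.card_fin]
  congr 1
  linarith

lemma StrictlyBalanced.mParam_eq {C : Matrix (Fin ℓ) (Fin k) ℤ} (hC : StrictlyBalanced C)
    (hf : FullRank C) (hk : 2 ≤ k) : mParam C = ((k : ℝ) - 1) / ((k : ℝ) - 1 - (ℓ : ℝ)) := by
  apply le_antisymm
  · obtain ⟨W, hW, h⟩ := exists_mRatio_eq_mParam C hk
    rw [← h]
    have hle := Finset.card_le_univ W
    rw [Fintype.card_fin] at hle
    rcases hle.eq_or_lt with he | hlt
    · rw [(Finset.card_eq_iff_eq_univ W).1 (by rw [he, Fintype.card_fin]), mRatio_univ hf]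
    · exact (hC.mRatio_lt hf hW hlt).le
  · rw [← mRatio_univ hf]
    exact mRatio_le_mParam C (by simpa using hk)

/-- If `m(A) = m(B)`, then this is also the value of `m(A, B)`. -/
lemma mPair_eq {ℓB kB : ℕ} {A : Matrix (Fin ℓ) (Fin k) ℤ} {B : Matrix (Fin ℓB) (Fin kB) ℤ}
    {m : ℝ} (hk : 2 ≤ k) (hA : Irredundant A 0) (hPR : PartitionRegular A) (hm : 0 < m)
    (hmA : mParam A = m) (hmB : mParam B = m) : mPair A B = m := by
  have hr : ∀ W : Finset (Fin k), 2 ≤ W.card → 0 < (projRank (ratKer A) W : ℝ) - 1 := by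
    intro W hW
    have : (2 : ℝ) ≤ projRank (ratKer A) W := by exact_mod_cast two_le_projRank hA hPR hW
    linarith
  have : Nonempty {W : Finset (Fin k) // 2 ≤ W.card} := ⟨⟨Finset.univ, by simpa using hk⟩⟩
  simp only [mPair, colRank_sub, hmB]
  apply le_antisymm
  · refine ciSup_le fun ⟨W, hW⟩ => ?_
    have h1 := hr W hW
    have h2 := mRatio_le_mParam A hW
    rw [hmA, mRatio, div_le_iff₀ h1] at h2
    rw [div_le_iff₀ (by positivity), mul_add, mul_one_div_cancel hm.ne']
    linarith
  · obtain ⟨W, hW, h⟩ := exists_mRatio_eq_mParam A hk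
    have h1 := hr W hW
    rw [hmA, mRatio, div_eq_iff h1.ne'] at h
    refine le_trans (le_of_eq ?_) (le_ciSup (f := fun W : {W : Finset (Fin k) // 2 ≤ W.card} =>
      (W.1.card : ℝ) / ((projRank (ratKer A) W.1 : ℝ) - 1 + 1 / m))
      (Set.finite_range _).bddAbove ⟨W, hW⟩)
    rw [eq_div_iff (by positivity), mul_add, mul_one_div_cancel hm.ne']
    linarith

end Parameters

/-! ### Sparseness of solution sets -/

section SparseSolutions

variable {k : ℕ}

/-- Cross-multiplying turns the strict inequality into one between natural numbers, which supplies
the `+ 1` in `balanced` and hence the fixed saving 1/(k - 1) in the exponent. -/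
lemma sparse_of_balanced {V : Submodule ℚ (Fin k → ℚ)} {Y : Set (Fin k → ℤ)}
    (hY : ∀ y ∈ Y, ∀ y' ∈ Y, (fun j => (y j : ℚ) - y' j) ∈ V) (hk : 2 ≤ k)
    (h1 : ∀ W : Finset (Fin k), 1 ≤ W.card → 1 ≤ projRank V W)
    (h2 : ∀ W : Finset (Fin k), 2 ≤ W.card → 2 ≤ projRank V W)
    (hb : ∀ W : Finset (Fin k), 2 ≤ W.card → W.card < k →
      ((W.card : ℝ) - 1) / ((projRank V W : ℝ) - 1) < ((k : ℝ) - 1) / ((finrank ℚ V : ℝ) - 1)) :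
    Sparse (finrank ℚ V) (projRank V) Y where
  le := projRank_le V
  one W hW := h1 W hW.ge
  two W hW := h2 W hW.ge
  balanced W hW hWk := by
    have hD : 2 ≤ finrank ℚ V := by
      rw [← projRank_univ]; exact h2 _ (by simpa using hk)
    have hr := h2 W hW
    have h := hb W hW hWk
    obtain ⟨w, hw⟩ : ∃ w, W.card = w + 1 := ⟨W.card - 1, by omega⟩
    obtain ⟨q, hq⟩ : ∃ q, projRank V W = q + 1 := ⟨projRank V W - 1, by omega⟩
    obtain ⟨d, hd⟩ : ∃ d, finrank ℚ V = d + 1 := ⟨finrank ℚ V - 1, by omega⟩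
    obtain ⟨m, hm⟩ : ∃ m, k = m + 1 := ⟨k - 1, by omega⟩
    have hkm : (k : ℝ) = m + 1 := by exact_mod_cast hm
    rw [hw, hq, hd, hkm] at h
    push_cast at h
    simp only [add_sub_cancel_right] at h
    have hq0 : (0 : ℝ) < q := by exact_mod_cast (by omega : 0 < q)
    have hd0 : (0 : ℝ) < d := by exact_mod_cast (by omega : 0 < d)
    rw [div_lt_div_iff₀ hq0 hd0] at h
    have h' : w * d < m * q := by exact_mod_cast h
    rw [hw, hq, hd, show k - 1 = m by omega]
    simpa using h'
  count n hn X W := card_solutions_le hY hn X W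

end SparseSolutions

/-! ### Passing from a system to its core. -/

section Core

variable {ℓA kA ℓ k : ℕ} {A : Matrix (Fin ℓA) (Fin kA) ℤ} {C : Matrix (Fin ℓ) (Fin k) ℤ}

/-- The equations of a core, for a subvector of a vector. -/
lemma core_mulVec {e : Fin k ↪o Fin kA} {P : Matrix (Fin ℓ) (Fin ℓA) ℚ}
    (h1 : ∀ i j, (P * A.map (Int.cast : ℤ → ℚ)) i (e j) = (C i j : ℚ))
    (h2 : ∀ i, ∀ j ∉ Set.range e, (P * A.map (Int.cast : ℤ → ℚ)) i j = 0) (x : Fin kA → ℤ) :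
    (fun i => ((C *ᵥ (x ∘ e)) i : ℚ)) = P *ᵥ (fun i => ((A *ᵥ x) i : ℚ)) := by
  rw [← map_cast_mulVec, ← map_cast_mulVec, Matrix.mulVec_mulVec]
  ext i
  simp only [Matrix.mulVec, dotProduct]
  refine Fintype.sum_of_injective e e.injective _ _ (fun j hj => ?_) (fun j => ?_)
  · rw [h2 i j hj, zero_mul]
  · rw [h1 i j]; simp

lemma IsCore.partitionRegular (h : IsCore A C) (hPR : PartitionRegular A) :
    PartitionRegular C := by
  obtain ⟨e, P, h1, h2⟩ := h.obtained
  intro r χ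
  obtain ⟨c, x, hx, hAx⟩ := hPR r χ
  refine ⟨c, x ∘ e, fun j => hx (e j), ?_⟩
  have := core_mulVec h1 h2 x
  rw [hAx] at this
  ext i
  have hi := congrFun this i
  simp only [Pi.zero_apply, Int.cast_zero] at hi
  rw [show (fun _ : Fin ℓA => (0 : ℚ)) = 0 from rfl, Matrix.mulVec_zero, Pi.zero_apply] at hi
  exact_mod_cast hi

/-- The solutions of a system contain members of a sparse family as subvectors. -/
lemma IsCore.exists_sparse (h : IsCore A C) (hPR : PartitionRegular A) (hk : 2 ≤ k)
    (b : Fin ℓA → ℤ) :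
    ∃ (r : Finset (Fin k) → ℕ) (Y : Set (Fin k → ℤ)), Sparse (k - ℓ) r Y ∧
      ∃ e : Fin k ↪ Fin kA, ∀ x, A *ᵥ x = b → x ∘ e ∈ Y := by
  obtain ⟨e, P, h1, h2⟩ := h.obtained
  have hPRC := h.partitionRegular hPR
  have hfr := finrank_ratKer_of_fullRank h.fullRank
  refine ⟨projRank (ratKer C), {y | ∃ x, A *ᵥ x = b ∧ x ∘ e = y}, ?_, e.toEmbedding,
    fun x hx => ⟨x, hx, rfl⟩⟩
  rw [show k - ℓ = finrank ℚ (ratKer C) by omega]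
  refine sparse_of_balanced ?_ hk (fun W hW => one_le_projRank_ratKer h.irredundant hW)
    (fun W hW => two_le_projRank h.irredundant hPRC hW) fun W hW hWk => ?_
  · rintro _ ⟨x, hx, rfl⟩ _ ⟨x', hx', rfl⟩
    -- The right-hand side cancels in differences, so inhomogeneous systems are treated like
    -- homogeneous ones.
    have := core_mulVec h1 h2 (x - x')
    rw [Matrix.mulVec_sub, hx, hx', sub_self] at this
    rw [mem_ratKer]
    have hcast : (fun j => (((x ∘ e) j : ℤ) : ℚ) - ((x' ∘ e) j : ℤ)) =
        fun j => ((((x - x') ∘ e) j : ℤ) : ℚ) := by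
      ext j; simp
    rw [hcast, map_cast_mulVec, this]
    simp only [Pi.zero_apply, Int.cast_zero]
    exact Matrix.mulVec_zero P
  · have := h.strictlyBalanced.mRatio_lt h.fullRank hW hWk
    rw [← mRatio_univ h.fullRank] at this
    simpa [mRatio, projRank_univ] using this

end Core

/-! ### The zero-statements -/

/-- If the solutions of two systems contain members of sparse families as subvectors, then below
the threshold the random set is almost surely not Rado. -/
lemma tendsto_measureReal_isRado {k D R : ℕ} (hD : 2 ≤ D) (hDk : D < k) (hR : 2 ≤ R)
    (A : Fin R → LinearSystem)
    (hA : ∀ i : Fin 2, ∃ (r : Finset (Fin k) → ℕ) (Y : Set (Fin k → ℤ)), Sparse D r Y ∧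
      ∃ e : Fin k ↪ Fin (A (Fin.castLE hR i)).cols,
        ∀ x, (A (Fin.castLE hR i)).mat *ᵥ x = (A (Fin.castLE hR i)).rhs → x ∘ e ∈ Y)
    (hpos : ∀ i, 0 < (A i).cols) (p : ℕ → I)
    (hp : ∀ᶠ n : ℕ in atTop, (p n : ℝ) ≤ 1 / (4 * (k : ℝ) ^ 2) * (n : ℝ) ^ (-expo k D)) :
    Tendsto (fun n => radoProb A n (p n)) atTop (𝓝 0) := by
  choose r Y hY e he using hA
  refine squeeze_zero (fun n => measureReal_nonneg) (fun n => ?_)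
    (tendsto_unavoidable hD hDk hY p hp)
  refine measureReal_mono (fun S hS => ?_) (measure_ne_top _ _)
  intro χ
  -- A two-colouring is read as a colouring that never uses the other colours; any coordinate of the
  -- monochromatic solution then shows that its colour is one of the first two.
  obtain ⟨i, x, ⟨hinj, hxS, hx⟩, hχ⟩ := hS (fun z => Fin.castLE hR (χ z))
  obtain ⟨i', rfl⟩ : ∃ i' : Fin 2, Fin.castLE hR i' = i := ⟨_, hχ ⟨0, hpos i⟩⟩
  exact ⟨i', x ∘ e i', he i' x hx, hinj.comp (e i').injective, fun j => hxS _, fun j =>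
    Fin.castLE_injective hR (hχ (e i' j))⟩

theorem tendsto_radoProb_pair {k ℓ : ℕ} (hℓ : 1 ≤ ℓ) (hk : ℓ + 2 ≤ k) (A B : LinearSystem)
    (hPA : PartitionRegular A.mat) (hPB : PartitionRegular B.mat)
    {CA CB : Matrix (Fin ℓ) (Fin k) ℤ} (hCA : IsCore A.mat CA) (hCB : IsCore B.mat CB)
    (p : ℕ → I) (hp : ∀ᶠ n : ℕ in atTop,
      (p n : ℝ) ≤ 1 / (4 * (k : ℝ) ^ 2) * (n : ℝ) ^ (-(((k : ℝ) - ℓ - 1) / ((k : ℝ) - 1)))) :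
    Tendsto (fun n => radoProb ![A, B] n (p n)) atTop (𝓝 0) := by
  have hcols : ∀ {S : LinearSystem} {C : Matrix (Fin ℓ) (Fin k) ℤ}, IsCore S.mat C →
      0 < S.cols := by
    intro S C h
    obtain ⟨e, -⟩ := h.obtained
    exact Fin.pos (e ⟨0, by omega⟩)
  refine tendsto_measureReal_isRado (D := k - ℓ) (k := k) (by omega) (by omega) le_rfl _ ?_ ?_ p ?_
  · intro i
    fin_cases i
    · exact hCA.exists_sparse hPA (by omega) A.rhs
    · exact hCB.exists_sparse hPB (by omega) B.rhs
  · intro i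
    fin_cases i
    · exact hcols hCA
    · exact hcols hCB
  · rw [expo, Nat.cast_sub (by omega)]
    exact hp

theorem exists_tendsto_radoProb {ℓ k : ℕ} (A : Matrix (Fin ℓ) (Fin k) ℤ) (hℓ : 1 ≤ ℓ)
    (hA : Irredundant A 0) (hPR : PartitionRegular A) (hf : FullRank A) (R : ℕ) (hR : 2 ≤ R) :
    ∃ c : ℝ, 0 < c ∧ ∀ p : ℕ → I,
      (∀ᶠ n : ℕ in atTop, (p n : ℝ) < c * (n : ℝ) ^ (-(1 / mParam A))) →
      Tendsto (fun n => radoProb (fun _ : Fin R => ⟨ℓ, k, A, 0⟩) n (p n)) atTop (𝓝 0) := by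
  classical
  have hfr := finrank_ratKer_of_fullRank hf
  have hk2 : 2 ≤ k := by
    by_contra h
    rcases Nat.eq_zero_or_pos k with h0 | h0
    · omega
    · have := one_le_projRank_ratKer hA (W := Finset.univ)
        (by rw [Finset.card_univ, Fintype.card_fin]; exact h0)
      rw [projRank_univ] at this
      omega
  have hD2 := two_le_projRank hA hPR (W := Finset.univ) (by simpa using hk2)
  rw [projRank_univ] at hD2
  obtain ⟨W₀, hW₀, hW₀m⟩ := exists_mRatio_eq_mParam A hk2
  -- A maximiser of smallest size: every proper subset with at least two elements has a strictly
  -- smaller ratio, so the projection to `W` is strictly balanced.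
  obtain ⟨W, hW, hmin⟩ := Finset.exists_min_image
    (Finset.univ.filter fun W : Finset (Fin k) => 2 ≤ W.card ∧ mRatio A W = mParam A)
    Finset.card ⟨W₀, by simp [hW₀, hW₀m]⟩
  simp only [Finset.mem_filter, Finset.mem_univ, true_and] at hW hmin
  obtain ⟨hW2, hWm⟩ := hW
  have hD : 2 ≤ projRank (ratKer A) W := two_le_projRank hA hPR hW2
  have hD' : (2 : ℝ) ≤ projRank (ratKer A) W := by exact_mod_cast hD
  -- The ratio of the full column set exceeds 1 because `ℓ ≥ 1`, so the maximal ratio does as well.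
  have hDW : projRank (ratKer A) W < W.card := by
    have h1 := mRatio_le_mParam A (W := Finset.univ) (by simpa using hk2)
    rw [mRatio_univ hf, ← hWm, mRatio] at h1
    have hkl : (ℓ : ℝ) + 2 ≤ k := by exact_mod_cast (by omega : ℓ + 2 ≤ k)
    have hl : (1 : ℝ) ≤ ℓ := by exact_mod_cast hℓ
    have h2 : 1 < ((k : ℝ) - 1) / ((k : ℝ) - 1 - (ℓ : ℝ)) := by
      rw [one_lt_div (by linarith)]; linarith
    have h3 := h2.trans_le h1
    rw [one_lt_div (by linarith)] at h3
    have h4 : (projRank (ratKer A) W : ℝ) < W.card := by linarith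
    exact_mod_cast h4
  let e : Fin W.card ↪ Fin k := (W.orderEmbOfFin rfl).toEmbedding
  have hemap : Finset.univ.map e = W := Finset.map_orderEmbOfFin_univ W rfl
  set V := (ratKer A).map (LinearMap.funLeft ℚ ℚ e) with hV
  have hVr : ∀ U, projRank V U = projRank (ratKer A) (U.map e) := projRank_map_funLeft _ e
  have hVD : finrank ℚ V = projRank (ratKer A) W := by rw [← projRank_univ, hVr, hemap]
  have hexpo : expo W.card (projRank (ratKer A) W) = 1 / mParam A := by
    rw [← hWm, mRatio, expo, one_div_div]
  have hsparse : Sparse (projRank (ratKer A) W) (projRank V) {y | ∃ x, A *ᵥ x = 0 ∧ x ∘ e = y} := by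
    rw [← hVD]
    refine sparse_of_balanced ?_ hW2 ?_ ?_ ?_
    · rintro _ ⟨x, hx, rfl⟩ _ ⟨x', hx', rfl⟩
      refine ⟨fun j => ((x - x') j : ℤ), cast_mem_ratKer ?_, ?_⟩
      · rw [Matrix.mulVec_sub, hx, hx', sub_self]
      · ext j; simp [LinearMap.funLeft_apply]
    · intro U hU
      rw [hVr]
      exact one_le_projRank_ratKer hA (by rwa [Finset.card_map])
    · intro U hU
      rw [hVr]
      exact two_le_projRank hA hPR (by rwa [Finset.card_map])
    · intro U hU hUW
      rw [hVr, hVD]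
      have hU' : 2 ≤ (U.map e).card := by rwa [Finset.card_map]
      have hlt : mRatio A (U.map e) < mRatio A W := by
        rw [hWm]
        refine lt_of_le_of_ne (mRatio_le_mParam A hU') fun heq => ?_
        have := hmin _ ⟨hU', heq⟩
        rw [Finset.card_map] at this
        omega
      simpa [mRatio] using hlt
  refine ⟨1 / (4 * (W.card : ℝ) ^ 2), ?_, fun p hp => ?_⟩
  · have : (0 : ℝ) < W.card := by exact_mod_cast (by omega : 0 < W.card)
    positivity
  · refine tendsto_measureReal_isRado hD hDW hR _
      (fun i => ⟨_, _, hsparse, e, fun x hx => ⟨x, hx, rfl⟩⟩) (fun i => ?_) p ?_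
    · change 0 < k
      omega
    · rw [hexpo]
      filter_upwards [hp] with n hn using hn.le

end RandomRado

end

theorem theorem1p6 :
    (∀ k ℓ : ℕ, 1 ≤ ℓ → ℓ + 2 ≤ k → ∃ c : ℝ, 0 < c ∧
      ∀ A B : RandomRado.LinearSystem,
        RandomRado.Irredundant A.mat A.rhs → RandomRado.Irredundant B.mat B.rhs →
        RandomRado.Irredundant A.mat 0 → RandomRado.Irredundant B.mat 0 →
        RandomRado.FullRank A.mat → RandomRado.FullRank B.mat →
        RandomRado.PartitionRegular A.mat → RandomRado.PartitionRegular B.mat →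
        ∀ CA CB : Matrix (Fin ℓ) (Fin k) ℤ,
        RandomRado.IsCore A.mat CA → RandomRado.IsCore B.mat CB →
        1 / RandomRado.mPair A.mat B.mat = ((k : ℝ) - ℓ - 1) / ((k : ℝ) - 1) ∧
        ∀ p : ℕ → unitInterval,
          (∀ᶠ n : ℕ in Filter.atTop,
            (p n : ℝ) ≤ c * (n : ℝ) ^ (-(1 / RandomRado.mPair A.mat B.mat))) →
          Filter.Tendsto (fun n => RandomRado.radoProb ![A, B] n (p n)) Filter.atTop (nhds 0)) ∧
    (∀ (ℓ k : ℕ) (A : Matrix (Fin ℓ) (Fin k) ℤ), 1 ≤ ℓ →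
      RandomRado.Irredundant A 0 → RandomRado.PartitionRegular A → RandomRado.FullRank A →
      ∀ r : ℕ, 2 ≤ r → ∃ c : ℝ, 0 < c ∧
        ∀ p : ℕ → unitInterval,
          (∀ᶠ n : ℕ in Filter.atTop,
            (p n : ℝ) < c * (n : ℝ) ^ (-(1 / RandomRado.mParam A))) →
          Filter.Tendsto (fun n => RandomRado.radoProb (fun _ : Fin r => ⟨ℓ, k, A, 0⟩) n (p n))
            Filter.atTop (nhds 0)) := by
  refine ⟨fun k ℓ hℓ hk => ⟨1 / (4 * (k : ℝ) ^ 2), ?_, ?_⟩, fun ℓ k A hℓ hA hPR hf r hr =>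
    RandomRado.exists_tendsto_radoProb A hℓ hA hPR hf r hr⟩
  · have : (0 : ℝ) < k := by exact_mod_cast (by omega : 0 < k)
    positivity
  · intro A B _ _ hA _ _ _ hPA hPB CA CB hCA hCB
    have hkl : (ℓ : ℝ) + 2 ≤ k := by exact_mod_cast hk
    have hl : (1 : ℝ) ≤ ℓ := by exact_mod_cast hℓ
    have hcols : 2 ≤ A.cols := by
      obtain ⟨e, -⟩ := hCA.obtained
      have := Fintype.card_le_of_embedding e.toEmbedding
      simp only [Fintype.card_fin] at this
      omega
    have hmA := hCA.mParam_eq.symm.trans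
      (hCA.strictlyBalanced.mParam_eq hCA.fullRank (by omega))
    have hmB := hCB.mParam_eq.symm.trans
      (hCB.strictlyBalanced.mParam_eq hCB.fullRank (by omega))
    have hpair := RandomRado.mPair_eq hcols hA hPA
      (div_pos (by linarith) (by linarith)) hmA hmB
    have hval : 1 / RandomRado.mPair A.mat B.mat = ((k : ℝ) - ℓ - 1) / ((k : ℝ) - 1) := by
      rw [hpair, one_div_div]
      congr 1
      ring
    refine ⟨hval, fun p hp => ?_⟩
    rw [hval] at hp
    exact RandomRado.tendsto_radoProb_pair hℓ hk A B hPA hPB hCA hCB p hp
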